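/- Let $M$ be a closed (compact, without boundary) smooth Riemannian $n$-manifold, let $\Theta_0>0$, let $(U_a,x_a)_{a\in A}$ be a finite family of smooth coordinate charts of $M$, and let $L_a\subset U_a$ be compact sets. We write $|\cdot|_p$ for the norm on $\bigoplus_j\Lambda^jT_p^*M$ induced by the metric. For a smooth triangulation $K$ of $M$ by a finite simplicial complex with ordered vertices (a homeomorphism $|K|\to M$ that is a smooth immersion on every closed simplex), let $\mu_i$ denote the barycentric coordinate of the vertex $p_i$. Let $\eta=\eta(K)$, the mesh, be the supremum of the geodesic distances $r(p,q)$ over all vertices $p,q$ of a $1$-simplex, and let $\Theta(K)=\inf_\sigma \mathrm{vol}(\sigma)/\eta^n$, the fullness, be the infimum over all $n$-simplices. Let $R:\Omega^j(M)\to C^j(K)$, $R\omega(c)=\int_c\omega$, be the de Rham map to real simplicial cochains; let $W$ be the Whitney map, the linear map with $$W[p_0,\dots,p_j]=j!\sum_{i=0}^j(-1)^i\mu_i\,d\mu_0\wedge\dots\wedge\widehat{d\mu_i}\wedge\dots\wedge d\mu_j ,$$ which is evaluated on each closed $n$-simplex $\sigma$ by means of the restrictions of the functions $\mu_i$ to $\sigma$;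 and let $a\cup b=R(Wa\wedge Wb)$ for cochains $a,b$. Call an $n$-simplex $\sigma$ straight in $(U_a,x_a)$ if $\sigma\subset U_a$ and, on $\sigma$, the coordinates $x_a^1,\dots,x_a^n$ are affine functions of the barycentric coordinates. Then there is a constant $C$, depending only on $M$ with its metric, $\Theta_0$ and the family $(U_a,x_a,L_a)_{a\in A}$, such that for every smooth triangulation $K$ of $M$ with $\Theta(K)\ge\Theta_0$, every $n$-simplex $\sigma$ of $K$ and every $a\in A$ such that $\sigma\subset L_a$ and $\sigma$ is straight in $(U_a,x_a)$, all smooth forms $\omega_1,\omega_2\in\Omega(M)=\bigoplus_j\Omega^j(M)$ and all $p\in\sigma$, $$\big|W(R\omega_1\cup R\omega_2)(p)-\omega_1\wedge\omega_2(p)\big|_p\le C\Big(c_1\,\sup\Big|\frac{\partial\omega_2}{\partial x^i}\Big|+c_2\,\sup\Big|\frac{\partial\omega_1}{\partial x^i}\Big|\Big)\,\eta ,$$ where $c_m=\sup_{q\in\sigma}|\omega_m|_q$, the other suprema are those of $|\partial\omega_m/\partial x^i|_q$ over $q\in\sigma$ and $i=1,\dots,n$, and $\partial\omega/\partial x^i$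 is the form whose components in the coordinates $x=x_a$ are the partial derivatives with respect to $x^i$ of the components of $\omega$. -/

import Mathlib

open scoped Manifold ContDiff Bundle

noncomputable section

namespace WhitneyProduct

/-! ### Multilinear algebra -/

section Algebra

variable {E : Type*} [AddCommGroup E] [Module ℝ E]

/-- The exterior product of alternating forms, normalised by
`(α ∧ β) (v₁, …, vₘ) = ∑ sign · α (…) β (…)`, the sum running over the `(j, k)`-shuffles. -/
def wedge {j k m : ℕ} (h : j + k = m) (α : E [⋀^Fin j]→ₗ[ℝ] ℝ) (β : E [⋀^Fin k]→ₗ[ℝ] ℝ) :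
    E [⋀^Fin m]→ₗ[ℝ] ℝ :=
  ((LinearMap.mul' ℝ ℝ).compAlternatingMap (α.domCoprod β)).domDomCongr
    (finSumFinEquiv.trans (finCongr h))

/-- `θ₁ ∧ … ∧ θⱼ` for covectors `θₐ`: the form `(v₁, …, vⱼ) ↦ det (θₐ (v_b))`. -/
def wedgeCovectors {j : ℕ} (θ : Fin j → Module.Dual ℝ E) : E [⋀^Fin j]→ₗ[ℝ] ℝ :=
  (Matrix.detRowAlternating (n := Fin j) (R := ℝ)).compLinearMap (LinearMap.pi θ)

variable (E) in
/-- Alternating forms on `E` of all degrees. For finite-dimensional `E` the factors of degree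
above the dimension vanish, so this is `⨁ⱼ Λʲ E*`. -/
abbrev Exterior := (j : ℕ) → E [⋀^Fin j]→ₗ[ℝ] ℝ

/-- The exterior product on `⨁ⱼ Λʲ E*`. -/
def Exterior.wedge (α β : Exterior E) : Exterior E := fun m =>
  ∑ x : {x : ℕ × ℕ // x ∈ Finset.HasAntidiagonal.antidiagonal m},
    WhitneyProduct.wedge (Finset.HasAntidiagonal.mem_antidiagonal.1 x.2) (α x.1.1) (β x.1.2)

end Algebra

section Norm

variable {E : Type*} [NormedAddCommGroup E] [InnerProductSpace ℝ E] [FiniteDimensional ℝ E]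

/-- The squared length of an alternating form for the inner product on `Λʲ E*` induced from `E`:
the sum of the squares of its components `α (e_{i₁}, …, e_{iⱼ})`, `i₁ < … < iⱼ`, in an orthonormal
basis of `E` (the sum does not depend on the basis). -/
def normSq {j : ℕ} (α : E [⋀^Fin j]→ₗ[ℝ] ℝ) : ℝ :=
  ∑ I : Fin j ↪o Fin (Module.finrank ℝ E), (α fun a => stdOrthonormalBasis ℝ E (I a)) ^ 2

/-- The Euclidean norm on `⨁ⱼ Λʲ E*`, the summands being orthogonal. -/
def Exterior.norm (α : Exterior E) : ℝ :=
  √(∑ j ∈ Finset.range (Module.finrank ℝ E + 1), normSq (α j))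

end Norm

/-! ### Simplices, cochains and Whitney forms -/

/-- The standard `m`-simplex in `ℝᵐ`: `tᵢ ≥ 0` and `∑ tᵢ ≤ 1`. -/
def corner (m : ℕ) : Set (Fin m → ℝ) := {t | (∀ i, 0 ≤ t i) ∧ ∑ i, t i ≤ 1}

/-- The barycentric coordinates `(1 - ∑ tᵢ, t₁, …, tₘ)` of the standard simplex. -/
def cornerBary {m : ℕ} (t : Fin m → ℝ) : Fin (m + 1) → ℝ := Fin.cons (1 - ∑ i, t i) t

section Complex

variable {V : Type*} [Fintype V] [LinearOrder V] (K : AbstractSimplicialComplex V)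

/-- The `m`-simplices of `K`. -/
def Simplex (m : ℕ) := {s : Finset V // s ∈ K.faces ∧ s.card = m + 1}

instance (m : ℕ) : Fintype (Simplex K m) := Fintype.ofInjective Subtype.val Subtype.val_injective

/-- The geometric realization `|K|`, as a subset of `ℝ^V`. -/
def realization : Set (V → ℝ) :=
  {t | t ∈ stdSimplex ℝ V ∧ Finset.univ.filter (fun v => t v ≠ 0) ∈ K.faces}

/-- Real simplicial cochains of all degrees, with respect to the orientations of the simplices
given by the ordering of the vertices. -/
abbrev Cochain := (j : ℕ) → Simplex K j → ℝ

variable {K}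

/-- The vertices of a simplex in increasing order. -/
def Simplex.vert {m : ℕ} (τ : Simplex K m) : Fin (m + 1) → V := τ.1.orderEmbOfFin τ.2.2

/-- The closed simplex `τ` as a subset of `|K|`. -/
def Simplex.carrier {m : ℕ} (τ : Simplex K m) : Set (V → ℝ) :=
  {t | t ∈ stdSimplex ℝ V ∧ ∀ v, v ∉ τ.1 → t v = 0}

/-- The affine parametrization of the closed simplex `τ ⊆ |K|` by the standard simplex that
respects the ordering of the vertices. -/
def Simplex.incl {m : ℕ} (τ : Simplex K m) (t : Fin m → ℝ) : V → ℝ :=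
  ∑ i, cornerBary t i • Pi.single (τ.vert i) (1 : ℝ)

/-- The Whitney form of a cochain at a point at which the barycentric coordinates `μ_v` have the
values `μ v` and the differentials `dμ v`:
`W [p₀, …, pⱼ] = j! ∑ᵢ (-1)ⁱ μᵢ dμ₀ ∧ … ∧ (omit dμᵢ) ∧ … ∧ dμⱼ`, extended linearly. -/
def whitneyForm {E : Type*} [AddCommGroup E] [Module ℝ E] (μ : V → ℝ) (dμ : V → Module.Dual ℝ E)
    (c : Cochain K) : Exterior E := fun j =>
  ∑ τ : Simplex K j, c j τ • ((j.factorial : ℝ) • ∑ i : Fin (j + 1),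
    ((-1 : ℝ) ^ (i : ℕ) * μ (τ.vert i)) •
      wedgeCovectors fun a : Fin j => dμ (τ.vert (i.succAbove a)))

/-- The restriction (pullback) of the Whitney form `W c` to the simplex `υ`, in the coordinates
of the standard simplex. -/
def whitneyOnSimplex {m : ℕ} (c : Cochain K) (υ : Simplex K m) (t : Fin m → ℝ) :
    Exterior (Fin m → ℝ) :=
  whitneyForm (υ.incl t) (fun v => (fderiv ℝ (fun u => υ.incl u v) t).toLinearMap) c

/-- The cochain product `a ∪ b = R (W a ∧ W b)`: its value on an `m`-simplex `υ` is the integral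
of `W a ∧ W b` over `υ`. -/
def cup (a b : Cochain K) : Cochain K := fun m υ =>
  ∫ t in corner m,
    (whitneyOnSimplex a υ t).wedge (whitneyOnSimplex b υ t) m (fun i => Pi.single i (1 : ℝ))

end Complex

/-! ### Manifolds: smooth forms and smooth triangulations -/

section Manifold

variable (n : ℕ) (M : Type*) [TopologicalSpace M] [ChartedSpace (EuclideanSpace ℝ (Fin n)) M]

instance (p : M) : FiniteDimensional ℝ (TangentSpace (𝓡 n) p) :=
  inferInstanceAs (FiniteDimensional ℝ (EuclideanSpace ℝ (Fin n)))

variable {n M} in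
/-- The expression of a field of `j`-forms in the coordinates `x`: its pullback by `x⁻¹`. -/
def coordRep (x : OpenPartialHomeomorph M (EuclideanSpace ℝ (Fin n))) {j : ℕ}
    (α : (p : M) → TangentSpace (𝓡 n) p [⋀^Fin j]→L[ℝ] ℝ) (y : EuclideanSpace ℝ (Fin n)) :
    EuclideanSpace ℝ (Fin n) [⋀^Fin j]→L[ℝ] ℝ :=
  (α (x.symm y)).compContinuousLinearMap (mfderiv (𝓡 n) (𝓡 n) x.symm y)

/-- Smooth differential forms on `M`, `Ω(M) = ⨁ⱼ Ωʲ(M)` (the forms of degree above `n` vanish). -/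
structure DiffForm where
  /-- the component of degree `j` at `p` -/
  toFun : (j : ℕ) → (p : M) → TangentSpace (𝓡 n) p [⋀^Fin j]→L[ℝ] ℝ
  smooth : ∀ j, ∀ x ∈ IsManifold.maximalAtlas (𝓡 n) ∞ M,
    ContDiffOn ℝ ∞ (coordRep x (toFun j)) x.target

/-- A smooth triangulation of `M` by an ordered finite simplicial complex: a homeomorphism
`|K| → M` whose restriction to every closed simplex is a smooth immersion. The homeomorphism is
given by a function `map` and its inverse `bary`, whose components are the barycentric
coordinates. -/
structure SmoothTriangulation (V : Type*) [Fintype V] [LinearOrder V] where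
  /-- the simplicial complex `K` -/
  complex : AbstractSimplicialComplex V
  /-- the homeomorphism `|K| → M` (its values outside `|K|` are irrelevant) -/
  map : (V → ℝ) → M
  /-- the inverse homeomorphism: `bary p v` is the barycentric coordinate `μ_v (p)` -/
  bary : M → V → ℝ
  continuousOn_map : ContinuousOn map (realization complex)
  continuous_bary : Continuous bary
  bary_mem : ∀ p, bary p ∈ realization complex
  map_bary : ∀ p, map (bary p) = p
  bary_map : ∀ t ∈ realization complex, bary (map t) = t
  smooth : ∀ (m : ℕ) (τ : Simplex complex m),
    ContMDiffOn 𝓘(ℝ, Fin m → ℝ) (𝓡 n) ∞ (fun t => map (τ.incl t)) (corner m)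
  immersion : ∀ (m : ℕ) (τ : Simplex complex m), ∀ t ∈ corner m, Function.Injective
    (mfderivWithin 𝓘(ℝ, Fin m → ℝ) (𝓡 n) (fun t => map (τ.incl t)) (corner m) t)

variable {n M}

namespace DiffForm

/-- The value of a form at a point. -/
def at_ (α : DiffForm n M) (p : M) : Exterior (TangentSpace (𝓡 n) p) :=
  fun j => (α.toFun j p).toAlternatingMap

/-- `∂α/∂xⁱ` at `p`: the form whose components with respect to `dx¹, …, dxⁿ` are the partial
derivatives with respect to `xⁱ` of the components of `α`. -/
def partialDeriv (α : DiffForm n M) (x : OpenPartialHomeomorph M (EuclideanSpace ℝ (Fin n)))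
    (i : Fin n) (p : M) : Exterior (TangentSpace (𝓡 n) p) := fun j =>
  (fderiv ℝ (coordRep x (α.toFun j)) (x p)
    (EuclideanSpace.single i (1 : ℝ))).toAlternatingMap.compLinearMap
      (mfderiv (𝓡 n) (𝓡 n) x p).toLinearMap

variable [Bundle.RiemannianBundle (fun p : M => TangentSpace (𝓡 n) p)]

/-- `sup |α|_p` over `p ∈ S`. -/
def supNorm (α : DiffForm n M) (S : Set M) : ℝ := ⨆ p : S, (α.at_ p.1).norm

/-- `sup |∂α/∂xⁱ|_p` over `p ∈ S` and `i = 1, …, n`. -/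
def supPartialDeriv (α : DiffForm n M) (x : OpenPartialHomeomorph M (EuclideanSpace ℝ (Fin n)))
    (S : Set M) : ℝ := ⨆ q : S × Fin n, (α.partialDeriv x q.2 q.1.1).norm

end DiffForm

namespace SmoothTriangulation

variable {V : Type*} [Fintype V] [LinearOrder V] (K : SmoothTriangulation n M V)

/-- The parametrization of a simplex of the triangulation by the standard simplex. -/
def param {m : ℕ} (τ : Simplex K.complex m) (t : Fin m → ℝ) : M := K.map (τ.incl t)

/-- The closed simplex `τ` as a subset of `M`. -/
def cell {m : ℕ} (τ : Simplex K.complex m) : Set M := K.map '' τ.carrier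

/-- The `i`-th partial derivative of the parametrization of `τ`. -/
def tangent {m : ℕ} (τ : Simplex K.complex m) (t : Fin m → ℝ) (i : Fin m) :
    TangentSpace (𝓡 n) (K.param τ t) :=
  mfderivWithin 𝓘(ℝ, Fin m → ℝ) (𝓡 n) (K.param τ) (corner m) t
    (Pi.single i (1 : ℝ) : Fin m → ℝ)

/-- The vertex `v` as a point of `M`. -/
def vertex (v : V) : M := K.map (Pi.single v 1)

/-- The de Rham map `R`: integration of forms over the simplices. -/
def deRham (α : DiffForm n M) : Cochain K.complex := fun j τ =>
  ∫ t in corner j, α.toFun j (K.param τ t) (K.tangent τ t)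

/-- The Whitney form `W c` on the closed `n`-simplex `σ`, at a point `p ∈ σ`: the differentials
of the barycentric coordinates are those of their restrictions to `σ`, which are smooth. -/
def whitney (c : Cochain K.complex) (σ : Simplex K.complex n) (p : M) :
    Exterior (TangentSpace (𝓡 n) p) :=
  whitneyForm (K.bary p)
    (fun v => (mfderivWithin (𝓡 n) 𝓘(ℝ, ℝ) (fun q => K.bary q v) (K.cell σ) p).toLinearMap) c

/-- The `n`-simplex `σ` is straight in the coordinates `x`: on `σ`, these coordinates are affine
functions of the barycentric coordinates. -/
def IsStraight (x : OpenPartialHomeomorph M (EuclideanSpace ℝ (Fin n)))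
    (σ : Simplex K.complex n) : Prop :=
  ∀ t ∈ σ.carrier, x (K.map t) = ∑ v ∈ σ.1, t v • x (K.vertex v)

variable [Bundle.RiemannianBundle (fun p : M => TangentSpace (𝓡 n) p)]

/-- The mesh `η`: the supremum of the geodesic distances of the pairs of vertices of
`1`-simplices (which are finite, the vertices being joined by an edge). -/
def mesh : ℝ :=
  ⨆ e : {e : V × V // e.1 ≠ e.2 ∧ {e.1, e.2} ∈ K.complex.faces},
    (Manifold.riemannianEDist (𝓡 n) (K.vertex e.1.1) (K.vertex e.1.2)).toReal

/-- The Riemannian volume of an `n`-simplex. -/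
def vol (σ : Simplex K.complex n) : ℝ :=
  ∫ t in corner n, √(Matrix.of fun i k => inner ℝ (K.tangent σ t i) (K.tangent σ t k)).det

/-- The fullness `Θ`: the infimum of `vol σ / ηⁿ` over the `n`-simplices `σ`. -/
def fullness : ℝ := ⨅ σ : Simplex K.complex n, K.vol σ / K.mesh ^ n

end SmoothTriangulation

end Manifold

end WhitneyProduct

end

/-!
In the coordinates `x` a straight simplex `σ` is an affine simplex, and the barycentric coordinates
are affine functions of `x`. Fix `p ∈ σ` and compare `ω₁`, `ω₂` with their values `α`, `β` at `p`,
regarded as forms with constant coefficients in the chart. For these the product is exact. Indeed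
`α` is reproduced by the Whitney map from its integrals over the faces of `σ`
(`whitneyForm_constCochain`): the Whitney form of a simplex is the determinant of the matrix with the
columns `μ, dμ(w₁), …, dμ(wⱼ)`, and the sum over the faces is the expansion of an alternating form
on `ℝ^V` in minors. Hence the integrals of `α` and `β` over the faces of `σ` multiply under `∪` like
`α` and `β` under `∧` (`cup_constCochain`), and `W (R α ∪ R β) = α ∧ β` on `σ`.

It remains to estimate errors. On a `j`-face of `σ` the cochain `R ωᵢ` is `O (sup |ωᵢ| ηʲ)`, and it
differs from the cochain of the constant form by `O (sup |∂ωᵢ| ηʲ⁺¹)`, because in the chart the edges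
of `σ` have length `O (η)`. The product `∪` is bilinear and bounded on the faces of `σ`, so the error
of `R ω₁ ∪ R ω₂` on an `m`-face is `O (ηᵐ⁺¹)` times the factor in parentheses in the statement. The
Whitney map contributes the product of `m` differentials `dμᵥ`, each of which is `O (1 / η)`
(`abs_whitneyForm_cup_sub_le`).

The two bounds in terms of `η` are where the geometry enters.
* The chart is Lipschitz for the geodesic distance on the compact set `L`
  (`exists_norm_chart_sub_le`): multiplied by a cut-off function it extends to a smooth map on `M`
  whose differential is bounded. This bounds the edges of `σ`.
* By Cramer's rule `dμᵥ` is a quotient whose numerator is of degree `n - 1` in the edges of `σ` and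
  whose denominator is the Euclidean volume of `σ`, up to a factor `n!`. The fullness bounds the
  denominator from below by a multiple of `ηⁿ`
  (`SmoothTriangulation.IsStraight.exists_abs_mfderivWithin_bary_le`).

The Riemannian and the Euclidean norm are comparable on `L`, by compactness, so that the suprema of
the norms `|·|_p` can be used to bound the components of the forms.
-/

namespace WhitneyProduct

/-! ### Exterior products -/

section Wedge

variable {E F : Type*} [AddCommGroup E] [Module ℝ E] [AddCommGroup F] [Module ℝ F]

theorem alternatingMap_sum_apply {ι κ : Type*} (s : Finset κ) (f : κ → E [⋀^ι]→ₗ[ℝ] ℝ)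
    (v : ι → E) : (∑ a ∈ s, f a) v = ∑ a ∈ s, f a v := by
  classical
  induction s using Finset.induction_on with
  | empty => simp
  | insert a s ha ih => rw [Finset.sum_insert ha, Finset.sum_insert ha, AlternatingMap.add_apply, ih]

/-- The exterior product as a sum over a fixed set of representatives of the shuffles. -/
theorem wedge_apply {j k m : ℕ} (h : j + k = m) (α : E [⋀^Fin j]→ₗ[ℝ] ℝ) (β : E [⋀^Fin k]→ₗ[ℝ] ℝ)
    (v : Fin m → E) :
    wedge h α β v = ∑ q : Equiv.Perm.ModSumCongr (Fin j) (Fin k),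
      ((Equiv.Perm.sign (Quotient.out q) : ℤ) : ℝ) *
        (α (fun i => v (finCongr h (finSumFinEquiv (Quotient.out q (Sum.inl i))))) *
          β (fun i => v (finCongr h (finSumFinEquiv (Quotient.out q (Sum.inr i)))))) := by
  simp only [wedge, AlternatingMap.domDomCongr_apply, LinearMap.compAlternatingMap_apply,
    AlternatingMap.domCoprod_apply, sum_apply, map_sum]
  refine Finset.sum_congr rfl fun q _ => ?_
  obtain ⟨s, hs⟩ : ∃ s, s = Quotient.out q := ⟨_, rfl⟩
  have hq : q = Quotient.mk'' s := by rw [hs]; exact (Quotient.out_eq' q).symm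
  rw [← hs, hq, AlternatingMap.domCoprod.summand_mk'']
  rcases Int.units_eq_one_or (Equiv.Perm.sign s) with h1 | h1 <;>
    simp [h1, MultilinearMap.domDomCongr_apply, MultilinearMap.domCoprod_apply]

theorem wedge_compLinearMap {j k m : ℕ} (h : j + k = m) (α : E [⋀^Fin j]→ₗ[ℝ] ℝ)
    (β : E [⋀^Fin k]→ₗ[ℝ] ℝ) (L : F →ₗ[ℝ] E) :
    (wedge h α β).compLinearMap L = wedge h (α.compLinearMap L) (β.compLinearMap L) := by
  ext v
  simp [wedge_apply]

theorem wedge_sub_wedge {j k m : ℕ} (h : j + k = m) (α α' : E [⋀^Fin j]→ₗ[ℝ] ℝ)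
    (β β' : E [⋀^Fin k]→ₗ[ℝ] ℝ) :
    wedge h α β - wedge h α' β' = wedge h (α - α') β + wedge h α' (β - β') := by
  ext v
  simp only [AlternatingMap.sub_apply, AlternatingMap.add_apply, wedge_apply,
    ← Finset.sum_sub_distrib, ← Finset.sum_add_distrib]
  exact Finset.sum_congr rfl fun q _ => by ring

/-- The exterior product of bounded forms is bounded, the number of shuffles being at most `m!`.
The vectors are measured by an arbitrary nonnegative function `N`. -/
theorem abs_wedge_le {j k m : ℕ} (h : j + k = m) (α : E [⋀^Fin j]→ₗ[ℝ] ℝ)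
    (β : E [⋀^Fin k]→ₗ[ℝ] ℝ) {A B : ℝ} (N : E → ℝ) (hN : ∀ v, 0 ≤ N v) (hA : 0 ≤ A)
    (hα : ∀ v, |α v| ≤ A * ∏ i, N (v i)) (hβ : ∀ v, |β v| ≤ B * ∏ i, N (v i)) (v : Fin m → E) :
    |wedge h α β v| ≤ m.factorial * (A * B) * ∏ i, N (v i) := by
  -- `B` may be negative if `N` vanishes on some of the vectors, so only this product is controlled.
  have hB : 0 ≤ B * ∏ i, N (v i) := by
    subst h
    have h1 := (abs_nonneg _).trans (hβ fun i => v (Fin.natAdd j i))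
    rw [Fin.prod_univ_add]
    calc (0 : ℝ) ≤ (∏ i : Fin j, N (v (Fin.castAdd k i))) *
          (B * ∏ i : Fin k, N (v (Fin.natAdd j i))) :=
        mul_nonneg (Finset.prod_nonneg fun i _ => hN _) h1
      _ = _ := by ring
  have hcard : (Fintype.card (Equiv.Perm.ModSumCongr (Fin j) (Fin k)) : ℝ) ≤ m.factorial := by
    have h1 : Fintype.card (Equiv.Perm.ModSumCongr (Fin j) (Fin k)) ≤
        Fintype.card (Equiv.Perm (Fin j ⊕ Fin k)) :=
      Fintype.card_le_of_surjective (Quotient.mk'') Quotient.mk''_surjective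
    rw [Fintype.card_perm, Fintype.card_sum, Fintype.card_fin, Fintype.card_fin, h] at h1
    exact_mod_cast h1
  rw [wedge_apply]
  refine (Finset.abs_sum_le_sum_abs _ _).trans ?_
  have key : ∀ q : Equiv.Perm.ModSumCongr (Fin j) (Fin k),
      |((Equiv.Perm.sign (Quotient.out q) : ℤ) : ℝ) *
        (α (fun i => v (finCongr h (finSumFinEquiv (Quotient.out q (Sum.inl i))))) *
          β (fun i => v (finCongr h (finSumFinEquiv (Quotient.out q (Sum.inr i))))))| ≤
        A * B * ∏ i, N (v i) := by
    intro q
    have hs : |((Equiv.Perm.sign (Quotient.out q) : ℤ) : ℝ)| = 1 := by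
      rcases Int.units_eq_one_or (Equiv.Perm.sign (Quotient.out q)) with h1 | h1 <;> simp [h1]
    have hprod : ∏ i, N (v i) =
        (∏ i, N (v (finCongr h (finSumFinEquiv (Quotient.out q (Sum.inl i)))))) *
          ∏ i, N (v (finCongr h (finSumFinEquiv (Quotient.out q (Sum.inr i))))) := by
      rw [← Equiv.prod_comp ((Quotient.out q).trans (finSumFinEquiv.trans (finCongr h))),
        Fintype.prod_sum_type]
      rfl
    rw [abs_mul, hs, one_mul, abs_mul, hprod]
    calc _ ≤ _ := mul_le_mul (hα _) (hβ _) (abs_nonneg _)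
            (mul_nonneg hA (Finset.prod_nonneg fun i _ => hN _))
      _ = _ := by ring
  refine (Finset.sum_le_sum fun q _ => key q).trans ?_
  rw [Finset.sum_const, nsmul_eq_mul, Finset.card_univ]
  calc _ ≤ (m.factorial : ℝ) * (A * B * ∏ i, N (v i)) := by
        refine mul_le_mul_of_nonneg_right hcard ?_
        rw [mul_assoc]; exact mul_nonneg hA hB
    _ = _ := by ring

/-- The pullback of an element of the exterior algebra of the dual. -/
def Exterior.comp (α : Exterior E) (L : F →ₗ[ℝ] E) : Exterior F := fun j => (α j).compLinearMap L

theorem Exterior.wedge_comp (α β : Exterior E) (L : F →ₗ[ℝ] E) :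
    (α.wedge β).comp L = (α.comp L).wedge (β.comp L) := by
  ext m v
  simp only [Exterior.comp, Exterior.wedge, ← wedge_compLinearMap,
    AlternatingMap.compLinearMap_apply, alternatingMap_sum_apply]

end Wedge

section Covectors

variable {E : Type*} [AddCommGroup E] [Module ℝ E]

theorem wedgeCovectors_apply {j : ℕ} (θ : Fin j → Module.Dual ℝ E) (v : Fin j → E) :
    wedgeCovectors θ v = (Matrix.of fun a b => θ a (v b)).det := by
  rw [← Matrix.det_transpose]
  rfl

theorem abs_wedgeCovectors_le {j : ℕ} (θ : Fin j → Module.Dual ℝ E) (N : E → ℝ) {δ : ℝ}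
    (hθ : ∀ a v, |θ a v| ≤ δ * N v) (v : Fin j → E) :
    |wedgeCovectors θ v| ≤ j.factorial * δ ^ j * ∏ i, N (v i) := by
  rw [wedgeCovectors_apply, Matrix.det_apply']
  refine (Finset.abs_sum_le_sum_abs _ _).trans ?_
  have key : ∀ s : Equiv.Perm (Fin j), |((Equiv.Perm.sign s : ℤ) : ℝ) *
      ∏ i, Matrix.of (fun a b => θ a (v b)) (s i) i| ≤ δ ^ j * ∏ i, N (v i) := by
    intro s
    have hs : |((Equiv.Perm.sign s : ℤ) : ℝ)| = 1 := by
      rcases Int.units_eq_one_or (Equiv.Perm.sign s) with h1 | h1 <;> simp [h1]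
    rw [abs_mul, hs, one_mul, Finset.abs_prod]
    calc _ ≤ ∏ i, δ * N (v i) := Finset.prod_le_prod (fun _ _ => abs_nonneg _) fun i _ => hθ _ _
      _ = _ := by simp [Finset.prod_mul_distrib]
  refine (Finset.sum_le_sum fun s _ => key s).trans ?_
  simp [Fintype.card_perm, mul_assoc]

/-- Expansion of an alternating form on `ℝ^V` in the standard basis, the coefficients being the
minors of the matrix of coordinates. -/
theorem alternating_eq_sum_minors {V : Type*} [Fintype V] [LinearOrder V] {k : ℕ}
    (Ω : (V → ℝ) [⋀^Fin k]→ₗ[ℝ] ℝ) (x : Fin k → V → ℝ) :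
    Ω x = ∑ s : Set.powersetCard V k,
      (Matrix.of fun a b => x b (Set.powersetCard.ofFinEmbEquiv.symm s a)).det *
        Ω (fun a => Pi.single (Set.powersetCard.ofFinEmbEquiv.symm s a) 1) := by
  rw [← exteriorPower.alternatingMapLinearEquiv_apply_ιMulti Ω x]
  conv_lhs => rw [← ((Pi.basisFun ℝ V).exteriorPower k).sum_repr (exteriorPower.ιMulti ℝ k x)]
  rw [map_sum]
  refine Finset.sum_congr rfl fun s _ => ?_
  rw [map_smul, smul_eq_mul, exteriorPower.basis_repr_apply, exteriorPower.ιMultiDual_apply_ιMulti,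
    exteriorPower.basis_apply, exteriorPower.ιMulti_family,
    exteriorPower.alternatingMapLinearEquiv_apply_ιMulti, ← Matrix.det_transpose]
  congr 2
  ext a
  simp

end Covectors

/-! ### Whitney forms of constant forms -/

section AlternatingCone

variable {X E : Type*} [AddCommGroup X] [Module ℝ X] [AddCommGroup E] [Module ℝ E]

/-- An alternating form does not change if its first argument is subtracted from the others. -/
theorem alternating_cons_sub {k : ℕ} (Ω : X [⋀^Fin (k + 1)]→ₗ[ℝ] ℝ) (a : X) (y : Fin k → X) :
    Ω (Fin.cons a fun b => y b - a) = Ω (Fin.cons a y) := by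
  classical
  have key : ∀ s : Finset (Fin k),
      Ω (Fin.cons a (s.piecewise (fun b => y b - a) y)) = Ω (Fin.cons a y) := by
    intro s
    induction s using Finset.induction_on with
    | empty => simp
    | insert i s hi ih =>
      rw [Finset.piecewise_insert, ← ih]
      set z := s.piecewise (fun b => y b - a) y with hz
      have hzi : z i = y i := by simp [hz, hi]
      have h0 : Ω (Function.update (Fin.cons a z : Fin (k + 1) → X) i.succ a) = 0 :=
        Ω.map_eq_zero_of_eq (i := 0) (j := i.succ) _
          (by rw [Function.update_of_ne (Fin.succ_ne_zero i).symm]; simp) (Fin.succ_ne_zero i).symm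
      rw [Fin.cons_update, Ω.map_update_sub, h0, sub_zero, ← hzi, ← Fin.cons_update,
        Function.update_eq_self]
  simpa using key Finset.univ

/-- The alternating form `ε ∧ P^* α`, where `ε` is a linear form and `P` a linear map. -/
def coneForm {j : ℕ} (ε : X →ₗ[ℝ] ℝ) (P : X →ₗ[ℝ] E) (α : E [⋀^Fin j]→ₗ[ℝ] ℝ) :
    X [⋀^Fin (j + 1)]→ₗ[ℝ] ℝ :=
  AlternatingMap.alternatizeUncurryFin (ε.smulRight (α.compLinearMap P))

theorem coneForm_apply_of_eq_zero {j : ℕ} (ε : X →ₗ[ℝ] ℝ) (P : X →ₗ[ℝ] E)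
    (α : E [⋀^Fin j]→ₗ[ℝ] ℝ) (x : Fin (j + 1) → X) (h0 : ε (x 0) = 1)
    (h1 : ∀ b : Fin j, ε (x b.succ) = 0) :
    coneForm ε P α x = α fun b => P (x b.succ) := by
  rw [coneForm, AlternatingMap.alternatizeUncurryFin_apply, Fin.sum_univ_succ]
  simp [h0, h1]
  rfl

theorem coneForm_apply_of_eq_one {j : ℕ} (ε : X →ₗ[ℝ] ℝ) (P : X →ₗ[ℝ] E)
    (α : E [⋀^Fin j]→ₗ[ℝ] ℝ) (x : Fin (j + 1) → X) (h1 : ∀ b, ε (x b) = 1) :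
    coneForm ε P α x = α fun b => P (x b.succ) - P (x 0) := by
  have h := alternating_cons_sub (coneForm ε P α) (x 0) (fun b => x b.succ)
  have hx : (Fin.cons (x 0) fun b : Fin j => x b.succ) = x := Fin.cons_self_tail x
  rw [hx] at h
  rw [← h, coneForm_apply_of_eq_zero]
  · simp
  · simp [h1]
  · simp [h1]

end AlternatingCone

section Vertices

variable {V : Type*} [LinearOrder V] {K : AbstractSimplicialComplex V}
  {F : Type*} [AddCommGroup F] [Module ℝ F]

/-- The edge vectors at the first vertex of a simplex whose vertices are placed by `P`. -/
def Simplex.edge {j : ℕ} (τ : Simplex K j) (P : V → F) : Fin j → F :=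
  fun i => P (τ.vert i.succ) - P (τ.vert 0)

theorem Simplex.vert_mem {j : ℕ} (τ : Simplex K j) (i : Fin (j + 1)) : τ.vert i ∈ τ.1 :=
  Finset.orderEmbOfFin_mem _ _ _

theorem Simplex.vert_injective {j : ℕ} (τ : Simplex K j) : Function.Injective τ.vert :=
  (τ.1.orderEmbOfFin τ.2.2).injective

theorem Simplex.exists_vert_eq {j : ℕ} (τ : Simplex K j) {v : V} (hv : v ∈ τ.1) :
    ∃ i, τ.vert i = v := by
  have h := Finset.range_orderEmbOfFin τ.1 τ.2.2
  have h1 : v ∈ Set.range (τ.1.orderEmbOfFin τ.2.2) := by rw [h]; exact hv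
  exact h1

theorem Simplex.sum_vert {A : Type*} [AddCommMonoid A] {j : ℕ} (τ : Simplex K j) (f : V → A) :
    ∑ i, f (τ.vert i) = ∑ v ∈ τ.1, f v := by
  refine Finset.sum_bij (fun i _ => τ.vert i) (fun i _ => τ.vert_mem i)
    (fun i _ i' _ h => τ.vert_injective h) (fun v hv => ?_) (fun _ _ => rfl)
  obtain ⟨i, hi⟩ := τ.exists_vert_eq hv
  exact ⟨i, Finset.mem_univ _, hi⟩

end Vertices

section Determinant

variable {V : Type*} {E : Type*} [AddCommGroup E] [Module ℝ E]

theorem det_cons_eq_zero {μ : V → ℝ} {dμ : V → Module.Dual ℝ E} {s : Finset V}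
    (hμ : ∀ v ∉ s, μ v = 0) (hdμ : ∀ v ∉ s, dμ v = 0) {j : ℕ} (p : Fin (j + 1) → V)
    (w : Fin j → E) (hp : ∃ a, p a ∉ s) :
    (Matrix.of fun a : Fin (j + 1) =>
        (Fin.cons (μ (p a)) fun b => dμ (p a) (w b) : Fin (j + 1) → ℝ)).det = 0 := by
  obtain ⟨a, ha⟩ := hp
  refine Matrix.det_eq_zero_of_row_eq_zero a fun b => ?_
  refine Fin.cases ?_ (fun b => ?_) b
  · simp [hμ _ ha]
  · simp [hdμ _ ha]

/-- The bound for the Whitney form of a simplex: `μ` is bounded by one, and each `dμ` by `δ`. -/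
theorem abs_det_cons_le {μ : V → ℝ} {dμ : V → Module.Dual ℝ E} (N : E → ℝ) {δ : ℝ}
    (hμ : ∀ v, |μ v| ≤ 1) (hdμ : ∀ v w, |dμ v w| ≤ δ * N w) {j : ℕ}
    (p : Fin (j + 1) → V) (w : Fin j → E) :
    |(Matrix.of fun a : Fin (j + 1) =>
        (Fin.cons (μ (p a)) fun b => dμ (p a) (w b) : Fin (j + 1) → ℝ)).det| ≤
      (j + 1).factorial * δ ^ j * ∏ i, N (w i) := by
  rw [Matrix.det_succ_column_zero]
  refine (Finset.abs_sum_le_sum_abs _ _).trans ?_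
  have key : ∀ i : Fin (j + 1), |(-1) ^ (i : ℕ) * (Matrix.of fun a : Fin (j + 1) =>
        (Fin.cons (μ (p a)) fun b => dμ (p a) (w b) : Fin (j + 1) → ℝ)) i 0 *
        ((Matrix.of fun a : Fin (j + 1) =>
        (Fin.cons (μ (p a)) fun b => dμ (p a) (w b) : Fin (j + 1) → ℝ)).submatrix
          i.succAbove Fin.succ).det| ≤ j.factorial * δ ^ j * ∏ i, N (w i) := by
    intro i
    rw [abs_mul, abs_mul, abs_pow, abs_neg, abs_one, one_pow, one_mul]
    have h1 := abs_wedgeCovectors_le (fun a => dμ (p (i.succAbove a))) N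
      (fun a v => hdμ _ _) w
    rw [wedgeCovectors_apply] at h1
    exact (mul_le_of_le_one_left (abs_nonneg _) (hμ _)).trans h1
  refine (Finset.sum_le_sum fun i _ => key i).trans ?_
  rw [Finset.sum_const, Finset.card_univ, Fintype.card_fin, nsmul_eq_mul, Nat.factorial_succ]
  push_cast
  exact le_of_eq (by ring)

end Determinant

section Whitney

variable {V : Type*} [Fintype V] [LinearOrder V] {K : AbstractSimplicialComplex V}
  {E F : Type*} [AddCommGroup E] [Module ℝ E] [AddCommGroup F] [Module ℝ F]

/-- The Laplace expansion along the column of barycentric coordinates: the Whitney form of a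
simplex is a determinant. -/
theorem whitneyForm_apply (μ : V → ℝ) (dμ : V → Module.Dual ℝ E) (c : Cochain K) (j : ℕ)
    (w : Fin j → E) :
    whitneyForm μ dμ c j w = ∑ τ : Simplex K j, c j τ * (j.factorial *
      (Matrix.of fun a : Fin (j + 1) =>
        (Fin.cons (μ (τ.vert a)) fun b => dμ (τ.vert a) (w b) : Fin (j + 1) → ℝ)).det) := by
  rw [whitneyForm, alternatingMap_sum_apply]
  refine Finset.sum_congr rfl fun τ _ => ?_
  rw [AlternatingMap.smul_apply, AlternatingMap.smul_apply, alternatingMap_sum_apply,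
    Matrix.det_succ_column_zero, smul_eq_mul, smul_eq_mul]
  congr 2
  refine Finset.sum_congr rfl fun i _ => ?_
  rw [AlternatingMap.smul_apply, smul_eq_mul, wedgeCovectors_apply]
  rfl

/-- Only the faces of the simplex at hand contribute to a Whitney form. -/
theorem whitneyForm_apply_eq_sum_faces {μ : V → ℝ} {dμ : V → Module.Dual ℝ E} {s : Finset V}
    (hμ : ∀ v ∉ s, μ v = 0) (hdμ : ∀ v ∉ s, dμ v = 0) (c : Cochain K) (j : ℕ) (w : Fin j → E) :
    whitneyForm μ dμ c j w = ∑ τ : Simplex K j with τ.1 ⊆ s, c j τ * (j.factorial *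
      (Matrix.of fun a : Fin (j + 1) =>
        (Fin.cons (μ (τ.vert a)) fun b => dμ (τ.vert a) (w b) : Fin (j + 1) → ℝ)).det) := by
  rw [whitneyForm_apply]
  refine (Finset.sum_filter_of_ne fun τ _ hτ => ?_).symm
  by_contra hs
  apply hτ
  rw [det_cons_eq_zero hμ hdμ, mul_zero, mul_zero]
  obtain ⟨v, hv, hvs⟩ := Finset.not_subset.1 hs
  obtain ⟨a, rfl⟩ := τ.exists_vert_eq hv
  exact ⟨a, hvs⟩

theorem whitneyForm_sub (μ : V → ℝ) (dμ : V → Module.Dual ℝ E) (c c' : Cochain K) (j : ℕ) :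
    whitneyForm μ dμ (c - c') j = whitneyForm μ dμ c j - whitneyForm μ dμ c' j := by
  ext w
  rw [AlternatingMap.sub_apply, whitneyForm_apply, whitneyForm_apply, whitneyForm_apply,
    ← Finset.sum_sub_distrib]
  exact Finset.sum_congr rfl fun τ _ => by simp only [Pi.sub_apply]; ring

theorem card_faces_le (s : Finset V) (j : ℕ) :
    (Finset.univ.filter fun τ : Simplex K j => τ.1 ⊆ s).card ≤ 2 ^ s.card := by
  rw [← Finset.card_powerset]
  refine Finset.card_le_card_of_injOn Subtype.val (fun τ hτ => ?_) Subtype.val_injective.injOn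
  simpa using hτ

/-- A constant depending only on the dimension, in the bound for Whitney forms. -/
def whitneyConst (n : ℕ) : ℝ := 2 ^ (n + 1) * (n.factorial * (n + 1).factorial)

theorem whitneyConst_nonneg (n : ℕ) : 0 ≤ whitneyConst n := by unfold whitneyConst; positivity

theorem abs_whitneyForm_le {μ : V → ℝ} {dμ : V → Module.Dual ℝ E} {s : Finset V} {n : ℕ}
    (hs : s.card ≤ n + 1) (hμs : ∀ v ∉ s, μ v = 0) (hdμs : ∀ v ∉ s, dμ v = 0)
    (N : E → ℝ) (hN : ∀ w, 0 ≤ N w) {δ B : ℝ} (hB : 0 ≤ B)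
    (hμ : ∀ v, |μ v| ≤ 1) (hdμ : ∀ v w, |dμ v w| ≤ δ * N w) (c : Cochain K) (j : ℕ)
    (hc : ∀ τ : Simplex K j, τ.1 ⊆ s → |c j τ| * δ ^ j ≤ B) (w : Fin j → E) :
    |whitneyForm μ dμ c j w| ≤ whitneyConst n * B * ∏ i, N (w i) := by
  have hP : 0 ≤ ∏ i, N (w i) := Finset.prod_nonneg fun i _ => hN _
  rw [whitneyForm_apply_eq_sum_faces hμs hdμs]
  refine (Finset.abs_sum_le_sum_abs _ _).trans ?_
  have key : ∀ τ ∈ Finset.univ.filter (fun τ : Simplex K j => τ.1 ⊆ s),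
      |c j τ * (j.factorial * (Matrix.of fun a : Fin (j + 1) =>
        (Fin.cons (μ (τ.vert a)) fun b => dμ (τ.vert a) (w b) : Fin (j + 1) → ℝ)).det)| ≤
      n.factorial * (n + 1).factorial * B * ∏ i, N (w i) := by
    intro τ hτ
    have hτs := (Finset.mem_filter.1 hτ).2
    have hj : j ≤ n := by
      have := Finset.card_le_card hτs
      have := τ.2.2
      omega
    rw [abs_mul, abs_mul, Nat.abs_cast]
    calc _ ≤ |c j τ| * (j.factorial * ((j + 1).factorial * δ ^ j * ∏ i, N (w i))) := by
          gcongr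
          exact abs_det_cons_le N hμ hdμ _ _
      _ = (j.factorial * (j + 1).factorial : ℝ) * (|c j τ| * δ ^ j) * ∏ i, N (w i) := by ring
      _ ≤ (j.factorial * (j + 1).factorial : ℝ) * B * ∏ i, N (w i) := by
          gcongr
          exact hc τ hτs
      _ ≤ _ := by
          have h1 : (j.factorial : ℝ) ≤ n.factorial := by exact_mod_cast Nat.factorial_le hj
          have h2 : ((j + 1).factorial : ℝ) ≤ (n + 1).factorial := by
            exact_mod_cast Nat.factorial_le (by omega)
          gcongr
  refine (Finset.sum_le_sum key).trans ?_
  rw [Finset.sum_const, nsmul_eq_mul]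
  have h2 : ((Finset.univ.filter fun τ : Simplex K j => τ.1 ⊆ s).card : ℝ) ≤ 2 ^ (n + 1) := by
    have := (card_faces_le (K := K) s j).trans (Nat.pow_le_pow_right two_pos hs)
    exact_mod_cast this
  calc _ ≤ (2 : ℝ) ^ (n + 1) * (n.factorial * (n + 1).factorial * B * ∏ i, N (w i)) := by
        gcongr
    _ = _ := by rw [whitneyConst]; ring

/-- The cochain of the integrals of a constant form `α` over the affine simplices with vertices
placed by `P`. -/
noncomputable def constCochain (P : V → F) (α : Exterior F) : Cochain K :=
  fun j τ => (j.factorial : ℝ)⁻¹ * α j (τ.edge P)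

/-- On an affine simplex the Whitney map reproduces constant forms: `W R α = α`. Here `μ`, `dμ` are
the barycentric coordinates and their differentials, and `∑ dμ_v P_v` is the differential of the
affine parametrization. -/
theorem whitneyForm_constCochain {m : ℕ} (υ : Simplex K m) {μ : V → ℝ}
    {dμ : V → Module.Dual ℝ E} (hμs : ∀ v ∉ υ.1, μ v = 0) (hdμs : ∀ v ∉ υ.1, dμ v = 0)
    (hμ : ∑ v, μ v = 1) (hdμ : ∑ v, dμ v = 0) (P : V → F) (α : Exterior F) :
    whitneyForm μ dμ (constCochain (K := K) P α) =
      α.comp (∑ v, (dμ v).smulRight (P v)) := by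
  classical
  ext j w
  -- Let `ε` be the sum of the coordinates of `ℝ^V`, and let `Q` send the basis vector of `v` to
  -- `P v`. The form `ε ∧ Q^* α` is evaluated on the vectors `μ, dμ(w₁), …, dμ(wⱼ)` in two ways:
  -- directly, since `ε` is `1` on the first and `0` on the others, and by expansion in minors.
  set ε : (V → ℝ) →ₗ[ℝ] ℝ := ∑ v, LinearMap.proj v with hε
  set Q : (V → ℝ) →ₗ[ℝ] F := ∑ v, (LinearMap.proj v).smulRight (P v) with hQ
  have hε1 : ∀ v, ε (Pi.single v 1) = 1 := by
    intro v; simp [hε, LinearMap.sum_apply]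
  have hQ1 : ∀ v, Q (Pi.single v 1) = P v := by
    intro v
    simp only [hQ, LinearMap.sum_apply, LinearMap.smulRight_apply, LinearMap.proj_apply]
    rw [Finset.sum_eq_single v] <;> simp +contextual
  set x : Fin (j + 1) → V → ℝ := Fin.cons μ fun b v => dμ v (w b) with hx
  have hx0 : ε (x 0) = 1 := by simp [hε, hx, LinearMap.sum_apply, hμ]
  have hx1 : ∀ b : Fin j, ε (x b.succ) = 0 := by
    intro b
    have := LinearMap.congr_fun hdμ (w b)
    simpa [hε, hx, LinearMap.sum_apply] using this
  have hmain := alternating_eq_sum_minors (coneForm ε Q (α j)) x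
  rw [coneForm_apply_of_eq_zero _ _ _ _ hx0 hx1] at hmain
  have hL : (α.comp (∑ v, (dμ v).smulRight (P v))) j w = α j fun b => Q (x b.succ) := by
    simp only [Exterior.comp, AlternatingMap.compLinearMap_apply]
    congr 1
    ext b
    simp [hQ, hx, LinearMap.sum_apply]
  rw [hL, hmain, whitneyForm_apply]
  refine Finset.sum_of_injOn (fun τ => ⟨τ.1, τ.2.2⟩)
    (fun τ _ τ' _ h => Subtype.ext
      (congrArg (fun s : Set.powersetCard V (j + 1) => s.1) h)) (by simp) ?_ ?_
  -- The minors of vertex sets that are not simplices of `K` vanish: such a set is not contained in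
  -- `υ`, so that one row of its minor is zero.
  · intro s _ hs
    have hsυ : ¬ s.1 ⊆ υ.1 := by
      intro hsub
      apply hs
      have hne : s.1.Nonempty := by
        rw [← Finset.card_pos, s.2]; omega
      exact ⟨⟨s.1, (K.isRelLowerSet_faces υ.2.1).2 hsub hne, s.2⟩,
        Finset.mem_coe.2 (Finset.mem_univ _), rfl⟩
    obtain ⟨v, hv, hvs⟩ := Finset.not_subset.1 hsυ
    obtain ⟨a, ha⟩ := (Set.powersetCard.mem_range_ofFinEmbEquiv_symm_iff_mem s v).2 hv
    have := det_cons_eq_zero hμs hdμs (fun a => Set.powersetCard.ofFinEmbEquiv.symm s a) w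
      ⟨a, by rw [ha]; exact hvs⟩
    refine mul_eq_zero_of_left ?_ _
    rw [← this]
    congr 1
    ext a b
    refine Fin.cases ?_ (fun b => ?_) b <;> simp [hx]
  -- The other minors are the determinants in the Whitney forms, and the values of `ε ∧ Q^* α` on
  -- the vertices of `τ` are those of `α` on the edges.
  · intro τ _
    have hτ : ∀ a, Set.powersetCard.ofFinEmbEquiv.symm
        (⟨τ.1, τ.2.2⟩ : Set.powersetCard V (j + 1)) a = τ.vert a := fun a => rfl
    simp only [hτ]
    rw [coneForm_apply_of_eq_one _ _ _ _ fun b => hε1 _, constCochain]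
    simp only [hQ1]
    have hdet : (Matrix.of fun a b => x b (τ.vert a)) = (Matrix.of fun a : Fin (j + 1) =>
        (Fin.cons (μ (τ.vert a)) fun b => dμ (τ.vert a) (w b) : Fin (j + 1) → ℝ)) := by
      ext a b
      refine Fin.cases ?_ (fun b => ?_) b <;> simp [hx]
    rw [hdet]
    have : (j.factorial : ℝ) ≠ 0 := by positivity
    unfold Simplex.edge
    field_simp

end Whitney

/-! ### The standard simplex -/

section Corner

open MeasureTheory

/-- The volume of the simplex `tᵢ ≥ 0`, `∑ tᵢ ≤ r`. Its slices are simplices of the same kind, of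
varying size. -/
theorem volume_scaled_corner (m : ℕ) : ∀ r : ℝ, 0 ≤ r →
    volume {t : Fin m → ℝ | (∀ i, 0 ≤ t i) ∧ ∑ i, t i ≤ r} =
      ENNReal.ofReal (r ^ m / m.factorial) := by
  induction m with
  | zero =>
    intro r hr
    have : {t : Fin 0 → ℝ | (∀ i, 0 ≤ t i) ∧ ∑ i, t i ≤ r} = Set.univ := by
      ext t; simp [hr]
    rw [this]
    simp [volume_pi]
  | succ m ih =>
    intro r hr
    set T : Set (ℝ × (Fin m → ℝ)) := {p | 0 ≤ p.1 ∧ (∀ i, 0 ≤ p.2 i) ∧ p.1 + ∑ i, p.2 i ≤ r}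
      with hT
    have hTm : MeasurableSet T := by
      have h1 : MeasurableSet {p : ℝ × (Fin m → ℝ) | 0 ≤ p.1} :=
        measurableSet_le measurable_const measurable_fst
      have h2 : MeasurableSet {p : ℝ × (Fin m → ℝ) | ∀ i, 0 ≤ p.2 i} := by
        rw [show {p : ℝ × (Fin m → ℝ) | ∀ i, 0 ≤ p.2 i} = ⋂ i, {p | 0 ≤ p.2 i} by ext; simp]
        exact MeasurableSet.iInter fun i => measurableSet_le measurable_const (by fun_prop)
      have h3 : MeasurableSet {p : ℝ × (Fin m → ℝ) | p.1 + ∑ i, p.2 i ≤ r} :=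
        measurableSet_le (by fun_prop) measurable_const
      exact h1.inter (h2.inter h3)
    have hpre : {t : Fin (m + 1) → ℝ | (∀ i, 0 ≤ t i) ∧ ∑ i, t i ≤ r} =
        MeasurableEquiv.piFinSuccAbove (fun _ => ℝ) 0 ⁻¹' T := by
      ext t
      simp [hT, Fin.forall_fin_succ, Fin.sum_univ_succ, MeasurableEquiv.piFinSuccAbove,
        Fin.insertNthEquiv, Fin.tail, and_assoc]
    rw [hpre, (volume_preserving_piFinSuccAbove (fun _ => ℝ) 0).measure_preimage_equiv,
      Measure.volume_eq_prod, Measure.prod_apply hTm]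
    have hslice : ∀ s : ℝ, volume (Prod.mk s ⁻¹' T) =
        (Set.Icc 0 r).indicator (fun s => ENNReal.ofReal ((r - s) ^ m / m.factorial)) s := by
      intro s
      by_cases hs : s ∈ Set.Icc 0 r
      · rw [Set.indicator_of_mem hs, ← ih (r - s) (by linarith [hs.2])]
        congr 1
        ext t
        simp only [hT, Set.mem_preimage, Set.mem_ofPred_eq]
        constructor
        · rintro ⟨_, h1, h2⟩; exact ⟨h1, by linarith⟩
        · rintro ⟨h1, h2⟩; exact ⟨hs.1, h1, by linarith⟩
      · rw [Set.indicator_of_notMem hs]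
        have : Prod.mk s ⁻¹' T = ∅ := by
          ext t
          simp only [hT, Set.mem_preimage, Set.mem_ofPred_eq, Set.mem_empty_iff_false, iff_false]
          rintro ⟨h0, h1, h2⟩
          exact hs ⟨h0, by linarith [Finset.sum_nonneg fun i (_ : i ∈ Finset.univ) => h1 i]⟩
        rw [this, measure_empty]
    simp_rw [hslice]
    rw [lintegral_indicator measurableSet_Icc, ← ofReal_integral_eq_lintegral_ofReal]
    · congr 1
      rw [integral_Icc_eq_integral_Ioc, ← intervalIntegral.integral_of_le hr,
        intervalIntegral.integral_div, intervalIntegral.integral_comp_sub_left (fun x => x ^ m) r,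
        integral_pow, Nat.factorial_succ]
      have h1 : (m.factorial : ℝ) ≠ 0 := by positivity
      have h2 : (m : ℝ) + 1 ≠ 0 := by positivity
      push_cast
      field_simp
      simp
    · exact (Continuous.continuousOn (by fun_prop)).integrableOn_Icc
    · refine (ae_restrict_mem measurableSet_Icc).mono fun s hs => ?_
      have : 0 ≤ r - s := by linarith [hs.2]
      simp only [Pi.zero_apply]
      positivity

theorem volume_real_corner (m : ℕ) :
    (volume : Measure (Fin m → ℝ)).real (corner m) = (m.factorial : ℝ)⁻¹ := by
  rw [Measure.real, corner, volume_scaled_corner m 1 zero_le_one,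
    ENNReal.toReal_ofReal (by positivity)]
  simp

theorem volume_corner_lt_top (m : ℕ) : (volume : Measure (Fin m → ℝ)) (corner m) < ⊤ := by
  rw [corner, volume_scaled_corner m 1 zero_le_one]
  exact ENNReal.ofReal_lt_top

theorem isClosed_corner (m : ℕ) : IsClosed (corner m) := by
  have h1 : IsClosed {t : Fin m → ℝ | ∀ i, 0 ≤ t i} := by
    rw [show {t : Fin m → ℝ | ∀ i, 0 ≤ t i} = ⋂ i, {t | 0 ≤ t i} by ext; simp]
    exact isClosed_iInter fun i => isClosed_le continuous_const (by fun_prop)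
  exact h1.inter (isClosed_le (f := fun t : Fin m → ℝ => ∑ i, t i) (by fun_prop) continuous_const)

theorem isCompact_corner (m : ℕ) : IsCompact (corner m) := by
  refine (isCompact_Icc (a := (0 : Fin m → ℝ)) (b := 1)).of_isClosed_subset (isClosed_corner m) ?_
  intro t ht
  refine ⟨fun i => ht.1 i, fun i => ?_⟩
  exact (Finset.single_le_sum (fun i _ => ht.1 i) (Finset.mem_univ i)).trans ht.2

theorem convex_corner (m : ℕ) : Convex ℝ (corner m) := by
  intro s hs t ht a b ha hb hab
  refine ⟨fun i => ?_, ?_⟩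
  · have := hs.1 i
    have := ht.1 i
    simp only [Pi.add_apply, Pi.smul_apply, smul_eq_mul]
    positivity
  · simp only [Pi.add_apply, Pi.smul_apply, smul_eq_mul, Finset.sum_add_distrib,
      ← Finset.mul_sum]
    calc _ ≤ a * 1 + b * 1 := by gcongr; exacts [hs.2, ht.2]
      _ = 1 := by linarith

theorem interior_corner_nonempty (m : ℕ) : (interior (corner m)).Nonempty := by
  have hopen : IsOpen {t : Fin m → ℝ | (∀ i, 0 < t i) ∧ ∑ i, t i < 1} := by
    have h1 : IsOpen {t : Fin m → ℝ | ∀ i, 0 < t i} := by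
      rw [show {t : Fin m → ℝ | ∀ i, 0 < t i} = ⋂ i, {t | 0 < t i} by ext; simp]
      exact isOpen_iInter_of_finite fun i => isOpen_lt continuous_const (by fun_prop)
    exact h1.inter (isOpen_lt (f := fun t : Fin m → ℝ => ∑ i, t i) (by fun_prop) continuous_const)
  have hsub : {t : Fin m → ℝ | (∀ i, 0 < t i) ∧ ∑ i, t i < 1} ⊆ corner m :=
    fun t ht => ⟨fun i => (ht.1 i).le, ht.2.le⟩
  refine ⟨fun _ => ((m : ℝ) + 1)⁻¹, interior_maximal hsub hopen ⟨fun i => ?_, ?_⟩⟩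
  · positivity
  have : (0 : ℝ) < m + 1 := by positivity
  simp only [Finset.sum_const, Finset.card_univ, Fintype.card_fin, nsmul_eq_mul]
  rw [← div_eq_mul_inv, div_lt_one this]
  linarith

theorem uniqueDiffOn_corner (m : ℕ) : UniqueDiffOn ℝ (corner m) :=
  uniqueDiffOn_convex (convex_corner m) (interior_corner_nonempty m)

theorem cornerBary_nonneg {m : ℕ} {t : Fin m → ℝ} (ht : t ∈ corner m) (i : Fin (m + 1)) :
    0 ≤ cornerBary t i := by
  refine Fin.cases ?_ (fun i => ?_) i
  · simpa [cornerBary] using ht.2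
  · simpa [cornerBary] using ht.1 i

theorem sum_cornerBary {m : ℕ} (t : Fin m → ℝ) : ∑ i, cornerBary t i = 1 := by
  simp [cornerBary, Fin.sum_univ_succ]

/-- A combination with the barycentric coordinates as an affine function of `t`. -/
theorem sum_cornerBary_smul {A : Type*} [AddCommGroup A] [Module ℝ A] {m : ℕ} (t : Fin m → ℝ)
    (f : Fin (m + 1) → A) :
    ∑ i, cornerBary t i • f i = f 0 + ∑ i : Fin m, t i • (f i.succ - f 0) := by
  simp only [cornerBary, Fin.sum_univ_succ, Fin.cons_zero, Fin.cons_succ, smul_sub,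
    Finset.sum_sub_distrib, sub_smul, one_smul, ← Finset.sum_smul]
  abel

end Corner

/-! ### Whitney forms on a simplex, and the cup product -/

section Incl

variable {V : Type*} [LinearOrder V] {K : AbstractSimplicialComplex V}

theorem Simplex.incl_vert {m : ℕ} (τ : Simplex K m) (t : Fin m → ℝ) (i : Fin (m + 1)) :
    τ.incl t (τ.vert i) = cornerBary t i := by
  simp only [Simplex.incl, Finset.sum_apply, Pi.smul_apply, smul_eq_mul]
  rw [Finset.sum_eq_single i]
  · simp
  · intro b _ hb
    simp [τ.vert_injective.ne hb.symm]
  · simp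

theorem Simplex.incl_of_notMem {m : ℕ} (τ : Simplex K m) (t : Fin m → ℝ) {v : V} (hv : v ∉ τ.1) :
    τ.incl t v = 0 := by
  simp only [Simplex.incl, Finset.sum_apply, Pi.smul_apply, smul_eq_mul]
  refine Finset.sum_eq_zero fun i _ => ?_
  have : v ≠ τ.vert i := fun h => hv (h ▸ τ.vert_mem i)
  simp [this]

variable [Fintype V]

theorem Simplex.sum_incl_smul {A : Type*} [AddCommGroup A] [Module ℝ A] {m : ℕ} (τ : Simplex K m)
    (t : Fin m → ℝ) (P : V → A) :
    ∑ v, τ.incl t v • P v = ∑ i, cornerBary t i • P (τ.vert i) := by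
  rw [← Finset.sum_subset (Finset.subset_univ τ.1)
    (fun v _ hv => by rw [τ.incl_of_notMem t hv, zero_smul]),
    ← τ.sum_vert fun v => τ.incl t v • P v]
  simp only [τ.incl_vert]

theorem Simplex.incl_mem_carrier {m : ℕ} (τ : Simplex K m) {t : Fin m → ℝ} (ht : t ∈ corner m) :
    τ.incl t ∈ τ.carrier := by
  refine ⟨⟨fun v => ?_, ?_⟩, fun v hv => τ.incl_of_notMem t hv⟩
  · by_cases hv : v ∈ τ.1
    · obtain ⟨i, rfl⟩ := τ.exists_vert_eq hv
      rw [τ.incl_vert]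
      exact cornerBary_nonneg ht i
    · rw [τ.incl_of_notMem t hv]
  · have := τ.sum_incl_smul t (fun _ => (1 : ℝ))
    simpa [sum_cornerBary] using this

end Incl

section Cup

open MeasureTheory

variable {V : Type*} [LinearOrder V] {K : AbstractSimplicialComplex V}
  {F : Type*} [AddCommGroup F] [Module ℝ F]

/-- The differential of the barycentric coordinate of `v` in the coordinates of the standard
simplex. -/
def Simplex.inclDeriv {m : ℕ} (υ : Simplex K m) (v : V) : Module.Dual ℝ (Fin m → ℝ) :=
  ∑ i, υ.edge (fun v => (Pi.single v 1 : V → ℝ)) i v • LinearMap.proj i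

theorem Simplex.inclDeriv_apply {m : ℕ} (υ : Simplex K m) (v : V) (w : Fin m → ℝ) :
    υ.inclDeriv v w = ∑ i, υ.edge (fun v => (Pi.single v 1 : V → ℝ)) i v * w i := by
  simp [Simplex.inclDeriv, LinearMap.sum_apply]

theorem Simplex.incl_eq {m : ℕ} (υ : Simplex K m) (t : Fin m → ℝ) (v : V) :
    υ.incl t v = (Pi.single (υ.vert 0) 1 : V → ℝ) v + υ.inclDeriv v t := by
  rw [Simplex.incl, sum_cornerBary_smul, υ.inclDeriv_apply]
  simp [Simplex.edge, Finset.sum_apply, mul_comm]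

theorem Simplex.fderiv_incl {m : ℕ} (υ : Simplex K m) (v : V) (t : Fin m → ℝ) :
    (fderiv ℝ (fun u => υ.incl u v) t).toLinearMap = υ.inclDeriv v := by
  have h : (fun u => υ.incl u v) = fun u =>
      (Pi.single (υ.vert 0) 1 : V → ℝ) v + (LinearMap.toContinuousLinearMap (υ.inclDeriv v)) u := by
    ext u
    rw [υ.incl_eq]
    rfl
  rw [h, fderiv_const_add, ContinuousLinearMap.fderiv]
  rfl

theorem Simplex.inclDeriv_of_notMem {m : ℕ} (υ : Simplex K m) {v : V} (hv : v ∉ υ.1) :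
    υ.inclDeriv v = 0 := by
  refine LinearMap.ext fun w => ?_
  have h1 := υ.incl_eq w v
  have : v ≠ υ.vert 0 := fun h => hv (h ▸ υ.vert_mem 0)
  rw [υ.incl_of_notMem w hv, Pi.single_eq_of_ne this, zero_add] at h1
  simpa using h1.symm

theorem Simplex.abs_inclDeriv_le {m : ℕ} (υ : Simplex K m) (v : V) (w : Fin m → ℝ) :
    |υ.inclDeriv v w| ≤ m * ‖w‖ := by
  rw [υ.inclDeriv_apply]
  refine (Finset.abs_sum_le_sum_abs _ _).trans ?_
  have : ∀ i, |υ.edge (fun v => (Pi.single v 1 : V → ℝ)) i v * w i| ≤ ‖w‖ := by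
    intro i
    rw [abs_mul]
    refine (mul_le_of_le_one_left (abs_nonneg _) ?_).trans (norm_le_pi_norm w i)
    simp only [Simplex.edge, Pi.sub_apply, Pi.single_apply]
    split_ifs <;> norm_num
  refine (Finset.sum_le_sum fun i _ => this i).trans ?_
  simp

variable [Fintype V]

theorem Simplex.sum_inclDeriv_smulRight {m : ℕ} (υ : Simplex K m) (P : V → F) (w : Fin m → ℝ) :
    (∑ v, (υ.inclDeriv v).smulRight (P v)) w = ∑ i, w i • υ.edge P i := by
  have h : ∀ i, υ.edge P i = ∑ v, υ.edge (fun v => (Pi.single v 1 : V → ℝ)) i v • P v := by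
    intro i
    simp [Simplex.edge, sub_smul, Finset.sum_sub_distrib, Pi.single_apply]
  simp only [LinearMap.sum_apply, LinearMap.smulRight_apply, υ.inclDeriv_apply, Finset.sum_smul, h,
    Finset.smul_sum, smul_smul]
  rw [Finset.sum_comm]
  simp only [mul_comm]

theorem Simplex.sum_inclDeriv {m : ℕ} (υ : Simplex K m) : ∑ v, υ.inclDeriv v = 0 := by
  ext w
  have h := υ.sum_inclDeriv_smulRight (fun _ => (1 : ℝ)) (Pi.single w 1)
  simpa [LinearMap.sum_apply, Simplex.edge] using h

theorem whitneyOnSimplex_eq {m : ℕ} (c : Cochain K) (υ : Simplex K m) (t : Fin m → ℝ) :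
    whitneyOnSimplex c υ t = whitneyForm (υ.incl t) υ.inclDeriv c := by
  simp only [whitneyOnSimplex, υ.fderiv_incl]

theorem Simplex.sum_incl {m : ℕ} (υ : Simplex K m) (t : Fin m → ℝ) : ∑ v, υ.incl t v = 1 := by
  have := υ.sum_incl_smul t (fun _ => (1 : ℝ))
  simpa [sum_cornerBary] using this

theorem Simplex.abs_incl_le {m : ℕ} (υ : Simplex K m) {t : Fin m → ℝ} (ht : t ∈ corner m) (v : V) :
    |υ.incl t v| ≤ 1 := by
  have h := (υ.incl_mem_carrier ht).1
  rw [abs_of_nonneg (h.1 v), ← h.2]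
  exact Finset.single_le_sum (fun v _ => h.1 v) (Finset.mem_univ v)

theorem continuous_whitneyOnSimplex {m : ℕ} (c : Cochain K) (υ : Simplex K m) (j : ℕ)
    (w : Fin j → Fin m → ℝ) : Continuous fun t => whitneyOnSimplex c υ t j w := by
  simp only [whitneyOnSimplex_eq, whitneyForm_apply]
  refine continuous_finsetSum _ fun τ _ => continuous_const.mul (continuous_const.mul ?_)
  refine Continuous.matrix_det (continuous_matrix fun a b => ?_)
  refine Fin.cases ?_ (fun b => ?_) b
  · simp only [υ.incl_eq, Matrix.of_apply, Fin.cons_zero]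
    exact continuous_const.add (LinearMap.continuous_of_finiteDimensional _)
  · simp only [Matrix.of_apply, Fin.cons_succ]
    exact continuous_const

theorem continuous_wedge_whitneyOnSimplex {m : ℕ} (a b : Cochain K) (υ : Simplex K m) (k : ℕ)
    (w : Fin k → Fin m → ℝ) :
    Continuous fun t => (whitneyOnSimplex a υ t).wedge (whitneyOnSimplex b υ t) k w := by
  simp only [Exterior.wedge, alternatingMap_sum_apply, wedge_apply]
  refine continuous_finsetSum _ fun x _ => continuous_finsetSum _ fun q _ =>
    continuous_const.mul (Continuous.mul ?_ ?_) <;>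
  exact continuous_whitneyOnSimplex _ _ _ _

theorem integrableOn_cup {m : ℕ} (a b : Cochain K) (υ : Simplex K m) :
    IntegrableOn (fun t => (whitneyOnSimplex a υ t).wedge (whitneyOnSimplex b υ t) m
      (fun i => Pi.single i (1 : ℝ))) (corner m) :=
  (continuous_wedge_whitneyOnSimplex a b υ m _).continuousOn.integrableOn_compact
    (isCompact_corner m)

/-- The Whitney form on a simplex of the cochain of a constant form is the pullback of that form. -/
theorem whitneyOnSimplex_constCochain {m : ℕ} (υ : Simplex K m) (P : V → F) (α : Exterior F)
    (t : Fin m → ℝ) :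
    whitneyOnSimplex (constCochain P α) υ t =
      α.comp (∑ v, (υ.inclDeriv v).smulRight (P v)) := by
  rw [whitneyOnSimplex_eq]
  exact whitneyForm_constCochain υ (fun v => υ.incl_of_notMem t) (fun v => υ.inclDeriv_of_notMem)
    (υ.sum_incl t) υ.sum_inclDeriv P α

/-- On cochains of constant forms the cup product is the exterior product. -/
theorem cup_constCochain (P : V → F) (α β : Exterior F) :
    cup (constCochain (K := K) P α) (constCochain P β) = constCochain P (α.wedge β) := by
  ext m υ
  have h : ∀ i : Fin m, (∑ v, (υ.inclDeriv v).smulRight (P v)) (Pi.single i (1 : ℝ)) =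
      υ.edge P i := by
    intro i
    rw [υ.sum_inclDeriv_smulRight, Finset.sum_eq_single i] <;> simp +contextual
  simp only [cup, whitneyOnSimplex_constCochain, ← Exterior.wedge_comp]
  rw [setIntegral_const, volume_real_corner, constCochain, smul_eq_mul, Exterior.comp,
    AlternatingMap.compLinearMap_apply]
  simp only [h]

/-- The constant in the bound for the cup product. -/
def cupConst (n : ℕ) : ℝ := (n + 1).factorial * (whitneyConst n * (n + 1) ^ n) ^ 2

theorem cupConst_nonneg (n : ℕ) : 0 ≤ cupConst n := by unfold cupConst; positivity

/-- The Whitney form of a cochain on a simplex is bounded by the values of the cochain on the faces.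
The bound keeps track of the scaling `h ^ j` in degree `j`. -/
theorem abs_whitneyOnSimplex_le {n m : ℕ} (hm : m ≤ n) (υ : Simplex K m) (c : Cochain K)
    {A h : ℝ} (hA : 0 ≤ A) (hh : 0 ≤ h) (hc : ∀ j (τ : Simplex K j), τ.1 ⊆ υ.1 → |c j τ| ≤ A * h ^ j)
    {t : Fin m → ℝ} (ht : t ∈ corner m) (j : ℕ) (w : Fin j → Fin m → ℝ) :
    |whitneyOnSimplex c υ t j w| ≤ whitneyConst n * (n + 1) ^ n * A * h ^ j * ∏ i, ‖w i‖ := by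
  rw [whitneyOnSimplex_eq]
  have hm' : (m : ℝ) ≤ n + 1 := by
    have : (m : ℝ) ≤ n := by exact_mod_cast hm
    linarith
  refine (abs_whitneyForm_le (s := υ.1) (n := n) (δ := n + 1) (B := A * h ^ j * (n + 1) ^ n)
    (by rw [υ.2.2]; omega) (fun v => υ.incl_of_notMem t) (fun v => υ.inclDeriv_of_notMem)
    (fun w => ‖w‖) (fun w => norm_nonneg _) (by positivity) (fun v => υ.abs_incl_le ht v)
    (fun v w => (υ.abs_inclDeriv_le v w).trans (by gcongr)) c j (fun τ hτ => ?_) w).trans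
    (le_of_eq (by ring))
  have hj : j ≤ n := by
    have := Finset.card_le_card hτ
    have := τ.2.2
    have := υ.2.2
    omega
  have h1 : (1 : ℝ) ≤ n + 1 := by linarith [Nat.cast_nonneg (α := ℝ) n]
  gcongr
  exact hc j τ hτ

theorem Exterior.abs_wedge_sub_wedge_le {E : Type*} [SeminormedAddCommGroup E] [Module ℝ E]
    {a b a' b' : Exterior E} {A B A' B' h : ℝ} (hA : 0 ≤ A) (hA' : 0 ≤ A') (hh : 0 ≤ h)
    (hb : ∀ j w, |b j w| ≤ B * h ^ j * ∏ i, ‖w i‖) (ha' : ∀ j w, |a' j w| ≤ A * h ^ j * ∏ i, ‖w i‖)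
    (hda : ∀ j w, |(a j - a' j) w| ≤ A' * h ^ j * ∏ i, ‖w i‖)
    (hdb : ∀ j w, |(b j - b' j) w| ≤ B' * h ^ j * ∏ i, ‖w i‖) (m : ℕ) (w : Fin m → E) :
    |a.wedge b m w - a'.wedge b' m w| ≤
      (m + 1).factorial * (A' * B + A * B') * h ^ m * ∏ i, ‖w i‖ := by
  simp only [Exterior.wedge, alternatingMap_sum_apply, ← Finset.sum_sub_distrib,
    ← AlternatingMap.sub_apply, wedge_sub_wedge]
  refine (Finset.abs_sum_le_sum_abs _ _).trans ?_
  have key : ∀ x : {x : ℕ × ℕ // x ∈ Finset.HasAntidiagonal.antidiagonal m},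
      |(WhitneyProduct.wedge (Finset.HasAntidiagonal.mem_antidiagonal.1 x.2)
          (a x.1.1 - a' x.1.1) (b x.1.2) +
        WhitneyProduct.wedge (Finset.HasAntidiagonal.mem_antidiagonal.1 x.2)
          (a' x.1.1) (b x.1.2 - b' x.1.2)) w| ≤
      m.factorial * (A' * B + A * B') * h ^ m * ∏ i, ‖w i‖ := by
    intro x
    have hx := Finset.HasAntidiagonal.mem_antidiagonal.1 x.2
    have hp : h ^ m = h ^ x.1.1 * h ^ x.1.2 := by rw [← pow_add, hx]
    rw [AlternatingMap.add_apply]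
    refine (abs_add_le _ _).trans ?_
    have h1 := abs_wedge_le hx (a x.1.1 - a' x.1.1) (b x.1.2) (fun v => ‖v‖)
      (fun v => norm_nonneg v) (by positivity) (hda x.1.1) (hb x.1.2) w
    have h2 := abs_wedge_le hx (a' x.1.1) (b x.1.2 - b' x.1.2) (fun v => ‖v‖)
      (fun v => norm_nonneg v) (by positivity) (ha' x.1.1) (hdb x.1.2) w
    refine (add_le_add h1 h2).trans (le_of_eq ?_)
    rw [hp]; ring
  refine (Finset.sum_le_sum fun x _ => key x).trans ?_
  rw [Finset.sum_const, Finset.card_univ, Fintype.card_coe, Finset.Nat.card_antidiagonal,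
    nsmul_eq_mul, Nat.factorial_succ]
  push_cast
  exact le_of_eq (by ring)

/-- The cochain product depends continuously on its factors, uniformly in the scale `h`. -/
theorem abs_cup_sub_cup_le {n m : ℕ} (hm : m ≤ n) (υ : Simplex K m) {a b a' b' : Cochain K}
    {A B A' B' h : ℝ} (hA : 0 ≤ A) (hB : 0 ≤ B) (hA' : 0 ≤ A') (hB' : 0 ≤ B') (hh : 0 ≤ h)
    (hb : ∀ j (τ : Simplex K j), τ.1 ⊆ υ.1 → |b j τ| ≤ B * h ^ j)
    (ha' : ∀ j (τ : Simplex K j), τ.1 ⊆ υ.1 → |a' j τ| ≤ A * h ^ j)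
    (hda : ∀ j (τ : Simplex K j), τ.1 ⊆ υ.1 → |a j τ - a' j τ| ≤ A' * h ^ j)
    (hdb : ∀ j (τ : Simplex K j), τ.1 ⊆ υ.1 → |b j τ - b' j τ| ≤ B' * h ^ j) :
    |cup a b m υ - cup a' b' m υ| ≤ cupConst n * (A' * B + A * B') * h ^ m := by
  have hW := whitneyConst_nonneg n
  rw [cup, cup, ← integral_sub (integrableOn_cup a b υ) (integrableOn_cup a' b' υ),
    ← Real.norm_eq_abs]
  refine (norm_setIntegral_le_of_norm_le_const (C := cupConst n * (A' * B + A * B') * h ^ m)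
    (volume_corner_lt_top m) fun t ht => ?_).trans ?_
  · rw [Real.norm_eq_abs]
    have hdiff : ∀ (c c' : Cochain K) (j : ℕ), whitneyOnSimplex c υ t j -
        whitneyOnSimplex c' υ t j = whitneyOnSimplex (c - c') υ t j := by
      intro c c' j
      rw [whitneyOnSimplex_eq, whitneyOnSimplex_eq, whitneyOnSimplex_eq, whitneyForm_sub]
    refine (Exterior.abs_wedge_sub_wedge_le (A := whitneyConst n * (n + 1) ^ n * A)
      (B := whitneyConst n * (n + 1) ^ n * B) (A' := whitneyConst n * (n + 1) ^ n * A')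
      (B' := whitneyConst n * (n + 1) ^ n * B') (by positivity) (by positivity) hh
      (fun j w => abs_whitneyOnSimplex_le hm υ b hB hh hb ht j w)
      (fun j w => abs_whitneyOnSimplex_le hm υ a' hA hh ha' ht j w) (fun j w => ?_)
      (fun j w => ?_) m _).trans ?_
    · rw [hdiff]
      exact abs_whitneyOnSimplex_le hm υ (a - a') hA' hh hda ht j w
    · rw [hdiff]
      exact abs_whitneyOnSimplex_le hm υ (b - b') hB' hh hdb ht j w
    · have h1 : ((m + 1).factorial : ℝ) ≤ (n + 1).factorial := by
        exact_mod_cast Nat.factorial_le (by omega)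
      simp only [Pi.norm_single, norm_one, Finset.prod_const_one, mul_one]
      calc _ = ((m + 1).factorial : ℝ) * ((whitneyConst n * (n + 1) ^ n) ^ 2 *
            (A' * B + A * B') * h ^ m) := by ring
        _ ≤ ((n + 1).factorial : ℝ) * ((whitneyConst n * (n + 1) ^ n) ^ 2 *
            (A' * B + A * B') * h ^ m) := by gcongr
        _ = _ := by rw [cupConst]; ring
  · have hC := cupConst_nonneg n
    refine mul_le_of_le_one_right (by positivity) ?_
    rw [volume_real_corner]
    exact inv_le_one_of_one_le₀ (by exact_mod_cast Nat.succ_le_of_lt m.factorial_pos)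

/-- The estimate on one affine simplex: if the cochains `a`, `b` are close to the cochains of the
constant forms `α`, `β`, then the Whitney form of `a ∪ b` is close to `α ∧ β`. -/
theorem abs_whitneyForm_cup_sub_le {n : ℕ} (σ : Simplex K n) {E : Type*} [SeminormedAddCommGroup E]
    [Module ℝ E] {μ : V → ℝ} {dμ : V → Module.Dual ℝ E}
    (hμs : ∀ v ∉ σ.1, μ v = 0) (hdμs : ∀ v ∉ σ.1, dμ v = 0) (hμ : ∑ v, μ v = 1)
    (hμ1 : ∀ v, |μ v| ≤ 1) (hdμ : ∑ v, dμ v = 0) (P : V → F) (α β : Exterior F)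
    {a b : Cochain K} {A B A' B' h δ : ℝ} (hA : 0 ≤ A) (hB : 0 ≤ B) (hA' : 0 ≤ A') (hB' : 0 ≤ B')
    (hh : 0 ≤ h) {D : ℝ} (hδ : 0 ≤ δ) (hD1 : 1 ≤ D) (hD : h * δ ≤ D)
    (hdμ1 : ∀ v w, |dμ v w| ≤ δ * ‖w‖)
    (hb : ∀ j (τ : Simplex K j), τ.1 ⊆ σ.1 → |b j τ| ≤ B * h ^ j)
    (ha' : ∀ j (τ : Simplex K j), τ.1 ⊆ σ.1 → |constCochain P α j τ| ≤ A * h ^ j)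
    (hda : ∀ j (τ : Simplex K j), τ.1 ⊆ σ.1 → |a j τ - constCochain P α j τ| ≤ A' * h ^ j)
    (hdb : ∀ j (τ : Simplex K j), τ.1 ⊆ σ.1 → |b j τ - constCochain P β j τ| ≤ B' * h ^ j)
    (m : ℕ) (w : Fin m → E) :
    |(whitneyForm μ dμ (cup a b) m -
        (α.wedge β).comp (∑ v, (dμ v).smulRight (P v)) m) w| ≤
      whitneyConst n * (cupConst n * (A' * B + A * B') * D ^ n) * ∏ i, ‖w i‖ := by
  have hC := cupConst_nonneg n
  rw [← whitneyForm_constCochain σ hμs hdμs hμ hdμ P, ← cup_constCochain, ← whitneyForm_sub]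
  refine abs_whitneyForm_le (s := σ.1) (n := n) (δ := δ) σ.2.2.le hμs hdμs (fun w => ‖w‖)
    (fun w => norm_nonneg w) (by positivity) hμ1 hdμ1 _ m (fun τ hτ => ?_) w
  have hm : m ≤ n := by
    have := Finset.card_le_card hτ
    have := τ.2.2
    have := σ.2.2
    omega
  have h1 := abs_cup_sub_cup_le hm τ hA hB hA' hB' hh (fun j υ hυ => hb j υ (hυ.trans hτ))
    (fun j υ hυ => ha' j υ (hυ.trans hτ)) (fun j υ hυ => hda j υ (hυ.trans hτ))
    (fun j υ hυ => hdb j υ (hυ.trans hτ))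
  calc |(cup a b - cup (constCochain P α) (constCochain P β) : Cochain K) m τ| * δ ^ m
      ≤ cupConst n * (A' * B + A * B') * h ^ m * δ ^ m := by gcongr; exact h1
    _ = cupConst n * (A' * B + A * B') * (h * δ) ^ m := by rw [mul_pow]; ring
    _ ≤ cupConst n * (A' * B + A * B') * D ^ m := by gcongr
    _ ≤ cupConst n * (A' * B + A * B') * D ^ n := by gcongr

end Cup

/-! ### The norm of alternating forms on a Euclidean space -/

section Norm

variable {E : Type*} [NormedAddCommGroup E] [InnerProductSpace ℝ E] [FiniteDimensional ℝ E]

theorem normSq_nonneg {j : ℕ} (α : E [⋀^Fin j]→ₗ[ℝ] ℝ) : 0 ≤ normSq α :=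
  Finset.sum_nonneg fun _ _ => sq_nonneg _

theorem Exterior.norm_nonneg (α : Exterior E) : 0 ≤ α.norm := Real.sqrt_nonneg _

/-- There are at most `nʲ` components in degree `j`. -/
theorem Exterior.norm_le_of_abs_le {n : ℕ} (hn : Module.finrank ℝ E = n) (α : Exterior E) {B : ℝ}
    (hB : 0 ≤ B) (h : ∀ j v, |α j v| ≤ B * ∏ i, ‖v i‖) :
    α.norm ≤ √(∑ j ∈ Finset.range (n + 1), (n : ℝ) ^ j) * B := by
  have h1 : ∀ j, normSq (α j) ≤ (n : ℝ) ^ j * B ^ 2 := by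
    intro j
    have key : ∀ I : Fin j ↪o Fin (Module.finrank ℝ E),
        (α j fun a => stdOrthonormalBasis ℝ E (I a)) ^ 2 ≤ B ^ 2 := by
      intro I
      rw [← sq_abs]
      have := h j fun a => stdOrthonormalBasis ℝ E (I a)
      simp only [OrthonormalBasis.norm_eq_one, Finset.prod_const_one, mul_one] at this
      gcongr
    refine (Finset.sum_le_sum fun I _ => key I).trans ?_
    rw [Finset.sum_const, Finset.card_univ, nsmul_eq_mul]
    gcongr
    have := Fintype.card_le_of_injective
      (fun I : Fin j ↪o Fin (Module.finrank ℝ E) => (I : Fin j → Fin (Module.finrank ℝ E)))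
      DFunLike.coe_injective
    rw [Fintype.card_fun, Fintype.card_fin, Fintype.card_fin, hn] at this
    rw [hn]
    exact_mod_cast this
  rw [Exterior.norm, ← Real.sqrt_sq hB, ← Real.sqrt_mul (Finset.sum_nonneg fun _ _ => by positivity),
    Finset.sum_mul, hn]
  exact Real.sqrt_le_sqrt (Finset.sum_le_sum fun j _ => h1 j)

/-- The norm bounds all components in the orthonormal basis, also those whose indices are not
increasing. -/
theorem Exterior.abs_apply_basis_le (α : Exterior E) {j : ℕ}
    (f : Fin j → Fin (Module.finrank ℝ E)) :
    |α j fun a => stdOrthonormalBasis ℝ E (f a)| ≤ α.norm := by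
  by_cases hf : Function.Injective f
  · have hs : StrictMono (f ∘ Tuple.sort f) :=
      (Tuple.monotone_sort f).strictMono_of_injective (hf.comp (Tuple.sort f).injective)
    have h1 := (α j).map_perm (fun a => stdOrthonormalBasis ℝ E (f a)) (Tuple.sort f)
    have h2 : |α j fun a => stdOrthonormalBasis ℝ E (f a)| =
        |α j ((fun a => stdOrthonormalBasis ℝ E (f a)) ∘ Tuple.sort f)| := by
      rw [h1]
      rcases Int.units_eq_one_or (Equiv.Perm.sign (Tuple.sort f)) with h | h <;> simp [h]
    have hj : j ∈ Finset.range (Module.finrank ℝ E + 1) := by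
      have := Fintype.card_le_of_injective f hf
      rw [Fintype.card_fin, Fintype.card_fin] at this
      exact Finset.mem_range.2 (by omega)
    rw [h2]
    refine Real.abs_le_sqrt (le_trans ?_ (Finset.single_le_sum
      (fun j _ => normSq_nonneg (α j)) hj))
    exact Finset.single_le_sum (f := fun I : Fin j ↪o Fin (Module.finrank ℝ E) =>
      (α j fun a => stdOrthonormalBasis ℝ E (I a)) ^ 2) (fun _ _ => sq_nonneg _)
      (Finset.mem_univ (OrderEmbedding.ofStrictMono _ hs))
  · rw [Function.Injective] at hf
    push Not at hf
    obtain ⟨a, b, hab, hne⟩ := hf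
    rw [(α j).map_eq_zero_of_eq _ (by rw [hab]) hne, abs_zero]
    exact α.norm_nonneg

theorem alternating_eq_zero_of_finrank_lt {F : Type*} [AddCommGroup F] [Module ℝ F]
    [FiniteDimensional ℝ F] {j : ℕ} (hj : Module.finrank ℝ F < j) (α : F [⋀^Fin j]→ₗ[ℝ] ℝ)
    (v : Fin j → F) : α v = 0 := by
  refine α.map_linearDependent v fun h => ?_
  have := h.fintype_card_le_finrank
  rw [Fintype.card_fin] at this
  omega

/-- The norm of the exterior algebra bounds the values of the forms; in degrees above the dimension
there is nothing to prove. -/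
theorem Exterior.abs_apply_le {n : ℕ} (hn : Module.finrank ℝ E = n) (α : Exterior E) (j : ℕ)
    (v : Fin j → E) : |α j v| ≤ (n + 1) ^ n * α.norm * ∏ i, ‖v i‖ := by
  have h0 := α.norm_nonneg
  by_cases hj : n < j
  · rw [alternating_eq_zero_of_finrank_lt (hn ▸ hj), abs_zero]
    positivity
  set e := stdOrthonormalBasis ℝ E
  have hv : v = fun i => ∑ a, inner ℝ (e a) (v i) • e a := by
    ext i
    exact (e.sum_repr' (v i)).symm
  have hexp : α j v = ∑ f : Fin j → Fin (Module.finrank ℝ E),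
      (∏ i, inner ℝ (e (f i)) (v i)) * α j fun a => e (f a) := by
    conv_lhs => rw [hv]
    have := (α j).toMultilinearMap.map_sum (fun i a => inner ℝ (e a) (v i) • e a)
    refine this.trans (Finset.sum_congr rfl fun f _ => ?_)
    exact (α j).toMultilinearMap.map_smul_univ (fun i => inner ℝ (e (f i)) (v i)) _
  rw [hexp]
  refine (Finset.abs_sum_le_sum_abs _ _).trans ?_
  have key : ∀ f : Fin j → Fin (Module.finrank ℝ E),
      |(∏ i, inner ℝ (e (f i)) (v i)) * α j fun a => e (f a)| ≤ (∏ i, ‖v i‖) * α.norm := by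
    intro f
    rw [abs_mul, Finset.abs_prod]
    refine mul_le_mul (Finset.prod_le_prod (fun _ _ => abs_nonneg _) fun i _ => ?_)
      (α.abs_apply_basis_le f) (abs_nonneg _) (by positivity)
    refine (abs_real_inner_le_norm _ _).trans ?_
    rw [e.norm_eq_one, one_mul]
  refine (Finset.sum_le_sum fun f _ => key f).trans ?_
  rw [Finset.sum_const, Finset.card_univ, Fintype.card_fun, Fintype.card_fin, Fintype.card_fin, hn,
    nsmul_eq_mul]
  have h1 : ((n ^ j : ℕ) : ℝ) ≤ (n + 1) ^ n := by
    have : n ^ j ≤ (n + 1) ^ n :=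
      (Nat.pow_le_pow_left (Nat.le_succ n) j).trans (Nat.pow_le_pow_right (by omega) (by omega))
    exact_mod_cast this
  calc _ ≤ (n + 1 : ℝ) ^ n * ((∏ i, ‖v i‖) * α.norm) := by gcongr
    _ = _ := by ring

end Norm

/-! ### The metric in a chart -/

section Chart

open Set Filter Topology MeasureTheory

variable {n : ℕ} {M : Type*} [TopologicalSpace M] [ChartedSpace (EuclideanSpace ℝ (Fin n)) M]

/-- The differential of a chart at a point. -/
noncomputable def chartDeriv (x : OpenPartialHomeomorph M (EuclideanSpace ℝ (Fin n))) (p : M) :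
    TangentSpace (𝓡 n) p →L[ℝ] EuclideanSpace ℝ (Fin n) :=
  mfderiv (𝓡 n) (𝓡 n) x p

/-- The differential of the inverse of a chart. -/
noncomputable def chartSymmDeriv (x : OpenPartialHomeomorph M (EuclideanSpace ℝ (Fin n)))
    (y : EuclideanSpace ℝ (Fin n)) :
    EuclideanSpace ℝ (Fin n) →L[ℝ] TangentSpace (𝓡 n) (x.symm y) :=
  mfderiv (𝓡 n) (𝓡 n) x.symm y

variable {x : OpenPartialHomeomorph M (EuclideanSpace ℝ (Fin n))}

theorem mdifferentiable_of_mem_maximalAtlas (hx : x ∈ IsManifold.maximalAtlas (𝓡 n) ∞ M) :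
    x.MDifferentiable (𝓡 n) (𝓡 n) :=
  ⟨(contMDiffOn_of_mem_maximalAtlas hx).mdifferentiableOn (by simp),
    (contMDiffOn_symm_of_mem_maximalAtlas hx).mdifferentiableOn (by simp)⟩

theorem chartDeriv_chartSymmDeriv (hx : x ∈ IsManifold.maximalAtlas (𝓡 n) ∞ M)
    {y : EuclideanSpace ℝ (Fin n)} (hy : y ∈ x.target)
    (u : EuclideanSpace ℝ (Fin n)) : chartDeriv x (x.symm y) (chartSymmDeriv x y u) = u :=
  DFunLike.congr_fun ((mdifferentiable_of_mem_maximalAtlas hx).comp_symm_deriv hy) u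

theorem chartSymmDeriv_chartDeriv (hx : x ∈ IsManifold.maximalAtlas (𝓡 n) ∞ M)
    {y : EuclideanSpace ℝ (Fin n)} (hy : y ∈ x.target)
    (v : TangentSpace (𝓡 n) (x.symm y)) :
    chartSymmDeriv x y (chartDeriv x (x.symm y) v) = v := by
  have h := DFunLike.congr_fun
    ((mdifferentiable_of_mem_maximalAtlas hx).symm_comp_deriv (x.map_target hy)) v
  rw [x.right_inv hy] at h
  exact h

variable [IsManifold (𝓡 n) ∞ M] [Bundle.RiemannianBundle (fun p : M => TangentSpace (𝓡 n) p)]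
    [IsContMDiffRiemannianBundle (𝓡 n) ∞ (EuclideanSpace ℝ (Fin n))
      (fun p : M => TangentSpace (𝓡 n) p)]

theorem continuousOn_norm_chartSymmDeriv (hx : x ∈ IsManifold.maximalAtlas (𝓡 n) ∞ M) :
    ContinuousOn (fun q : EuclideanSpace ℝ (Fin n) × EuclideanSpace ℝ (Fin n) =>
      ‖chartSymmDeriv x q.1 q.2‖) (x.target ×ˢ univ) := by
  have : IsContinuousRiemannianBundle (EuclideanSpace ℝ (Fin n))
      (fun p : M => TangentSpace (𝓡 n) p) := by
    obtain ⟨g, hg, h⟩ := IsContMDiffRiemannianBundle.exists_contMDiff (IB := 𝓡 n) (n := ∞)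
      (F := EuclideanSpace ℝ (Fin n)) (E := fun p : M => TangentSpace (𝓡 n) p)
    exact ⟨⟨g, hg.continuous, h⟩⟩
  have h1 : ContinuousOn (fun q : EuclideanSpace ℝ (Fin n) × EuclideanSpace ℝ (Fin n) =>
      (⟨x.symm q.1, chartSymmDeriv x q.1 q.2⟩ : TangentBundle (𝓡 n) M)) (x.target ×ˢ univ) := by
    have h2 := (contMDiffOn_symm_of_mem_maximalAtlas hx).continuousOn_tangentMapWithin (by simp)
      x.open_target.uniqueMDiffOn
    have h3 := (tangentBundleModelSpaceHomeomorph (𝓡 n)).symm.continuous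
    refine (h2.comp (s := x.target ×ˢ univ) h3.continuousOn fun q hq => hq.1).congr fun q hq => ?_
    simp only [Function.comp_apply, tangentMapWithin]
    rw [chartSymmDeriv, ← mfderivWithin_of_isOpen x.open_target hq.1]
    rfl
  have h4 := ContinuousOn.inner_bundle h1 h1
  refine (Real.continuous_sqrt.comp_continuousOn h4).congr fun q _ => ?_
  exact norm_eq_sqrt_real_inner _

/-- On a compact set in the domain of a chart the Riemannian norm and the Euclidean norm in the
chart are equivalent. -/
theorem exists_norm_chartSymmDeriv_le (hx : x ∈ IsManifold.maximalAtlas (𝓡 n) ∞ M)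
    {S : Set (EuclideanSpace ℝ (Fin n))} (hS : IsCompact S)
    (hSx : S ⊆ x.target) : ∃ Λ : ℝ, 1 ≤ Λ ∧ ∀ y ∈ S, ∀ u : EuclideanSpace ℝ (Fin n),
      ‖chartSymmDeriv x y u‖ ≤ Λ * ‖u‖ ∧ ‖u‖ ≤ Λ * ‖chartSymmDeriv x y u‖ := by
  have hK : IsCompact (S ×ˢ Metric.sphere (0 : EuclideanSpace ℝ (Fin n)) 1) :=
    hS.prod (isCompact_sphere _ _)
  have hc := (continuousOn_norm_chartSymmDeriv hx).mono
    (Set.prod_mono hSx (subset_univ (Metric.sphere (0 : EuclideanSpace ℝ (Fin n)) 1)))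
  have hne : ∀ q ∈ S ×ˢ Metric.sphere (0 : EuclideanSpace ℝ (Fin n)) 1,
      ‖chartSymmDeriv x q.1 q.2‖ ≠ 0 := by
    rintro ⟨y, u⟩ ⟨hy, hu⟩ h0
    have h1 := chartDeriv_chartSymmDeriv hx (hSx hy) u
    rw [norm_eq_zero] at h0
    rw [h0, map_zero] at h1
    rw [mem_sphere_zero_iff_norm, ← h1, norm_zero] at hu
    exact zero_ne_one hu
  obtain ⟨C₁, hC₁⟩ := hK.exists_bound_of_continuousOn hc
  obtain ⟨C₂, hC₂⟩ := hK.exists_bound_of_continuousOn (hc.inv₀ hne)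
  refine ⟨max 1 (max C₁ C₂), le_max_left _ _, fun y hy u => ?_⟩
  rcases eq_or_ne u 0 with rfl | hu
  · simp
  have hu' : 0 < ‖u‖ := norm_pos_iff.2 hu
  set u₀ := ‖u‖⁻¹ • u with hu₀
  have hmem : (y, u₀) ∈ S ×ˢ Metric.sphere (0 : EuclideanSpace ℝ (Fin n)) 1 := by
    refine ⟨hy, ?_⟩
    rw [mem_sphere_zero_iff_norm, hu₀, norm_smul, norm_inv, norm_norm, inv_mul_cancel₀ hu'.ne']
  have h1 := hC₁ _ hmem
  have h2 := hC₂ _ hmem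
  have h3 : ‖chartSymmDeriv x y u₀‖ = ‖u‖⁻¹ * ‖chartSymmDeriv x y u‖ := by
    rw [hu₀, map_smul, norm_smul, norm_inv, norm_norm]
  have hpos : 0 < ‖chartSymmDeriv x y u‖ := by
    have := hne _ hmem
    simp only [h3] at this
    exact (norm_nonneg _).lt_of_ne' fun h => this (by rw [h, mul_zero])
  simp only [Pi.inv_apply, norm_mul, norm_norm, norm_inv, h3] at h1 h2
  constructor
  · have : ‖chartSymmDeriv x y u‖ ≤ C₁ * ‖u‖ := by
      rwa [inv_mul_le_iff₀ hu', mul_comm] at h1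
    exact this.trans (by gcongr; exact (le_max_left _ _).trans (le_max_right _ _))
  · have : ‖u‖ ≤ C₂ * ‖chartSymmDeriv x y u‖ := by
      rw [mul_inv, inv_inv, mul_inv_le_iff₀ hpos] at h2
      exact h2
    exact this.trans (by gcongr; exact (le_max_right _ _).trans (le_max_right _ _))

end Chart

/-! ### Charts and the Riemannian distance -/

section Distance

open Set Filter Topology MeasureTheory

variable {n : ℕ} {M : Type*} [TopologicalSpace M] [ChartedSpace (EuclideanSpace ℝ (Fin n)) M]
  [Bundle.RiemannianBundle (fun p : M => TangentSpace (𝓡 n) p)]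

/-- A smooth map is Lipschitz for the Riemannian distance if its differential is bounded. -/
theorem norm_sub_le_mul_riemannianEDist {E : Type*} [NormedAddCommGroup E] [NormedSpace ℝ E]
    {f : M → E} (hf : ContMDiff (𝓡 n) 𝓘(ℝ, E) 1 f) {C : ℝ} (hC : 0 ≤ C)
    (h : ∀ (p : M) (v : TangentSpace (𝓡 n) p),
      @norm E _ (mfderiv (𝓡 n) 𝓘(ℝ, E) f p v) ≤ C * ‖v‖) (p q : M)
    (hpq : Manifold.riemannianEDist (𝓡 n) p q ≠ ⊤) :
    ‖f p - f q‖ ≤ C * (Manifold.riemannianEDist (𝓡 n) p q).toReal := by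
  have key : ∀ r : ℝ, (Manifold.riemannianEDist (𝓡 n) p q).toReal < r → ‖f p - f q‖ ≤ C * r := by
    intro r hr
    have hr0 : 0 ≤ r := ENNReal.toReal_nonneg.trans hr.le
    -- The increment of `f` along a path from `p` to `q` of length less than `r`.
    obtain ⟨γ, hγ0, hγ1, hγ, hlen⟩ := Manifold.exists_lt_of_riemannianEDist_lt
      ((ENNReal.lt_ofReal_iff_toReal_lt hpq).2 hr)
    have hc : ContMDiffOn 𝓘(ℝ, ℝ) 𝓘(ℝ, E) 1 (f ∘ γ) (Icc 0 1) := hf.comp_contMDiffOn hγ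
    have h1 : ‖(f ∘ γ) 1 - (f ∘ γ) 0‖ₑ ≤ ENNReal.ofReal (C * r) := by
      calc ‖(f ∘ γ) 1 - (f ∘ γ) 0‖ₑ
          ≤ ∫⁻ t in Icc (0 : ℝ) 1, ‖derivWithin (f ∘ γ) (Icc 0 1) t‖ₑ :=
            enorm_sub_le_lintegral_derivWithin_Icc_of_contDiffOn_Icc
              (contMDiffOn_iff_contDiffOn.1 hc) zero_le_one
        _ ≤ ∫⁻ t in Icc (0 : ℝ) 1, ENNReal.ofReal C *
              ‖mfderivWithin 𝓘(ℝ, ℝ) (𝓡 n) γ (Icc 0 1) t 1‖ₑ := by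
            refine setLIntegral_mono' measurableSet_Icc fun t ht => ?_
            have h2 : mfderivWithin 𝓘(ℝ, ℝ) 𝓘(ℝ, E) (f ∘ γ) (Icc 0 1) t =
                (mfderiv (𝓡 n) 𝓘(ℝ, E) f (γ t)).comp
                  (mfderivWithin 𝓘(ℝ, ℝ) (𝓡 n) γ (Icc 0 1) t) := by
              apply mfderiv_comp_mfderivWithin
              · exact hf.mdifferentiableAt (by simp)
              · exact hγ.mdifferentiableOn (by simp) t ht
              · rw [uniqueMDiffWithinAt_iff_uniqueDiffWithinAt]
                exact uniqueDiffOn_Icc zero_lt_one t ht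
            have h3 : derivWithin (f ∘ γ) (Icc 0 1) t = mfderiv (𝓡 n) 𝓘(ℝ, E) f (γ t)
                (mfderivWithin 𝓘(ℝ, ℝ) (𝓡 n) γ (Icc 0 1) t 1) := by
              rw [← fderivWithin_derivWithin, ← mfderivWithin_eq_fderivWithin, h2]
              rfl
            rw [h3, ← ofReal_norm (mfderivWithin 𝓘(ℝ, ℝ) (𝓡 n) γ (Icc 0 1) t 1),
              ← ENNReal.ofReal_mul hC]
            refine le_trans (le_of_eq ?_) (ENNReal.ofReal_le_ofReal
              (h (γ t) (mfderivWithin 𝓘(ℝ, ℝ) (𝓡 n) γ (Icc 0 1) t 1)))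
            exact (ofReal_norm (E := E) _).symm
        _ = ENNReal.ofReal C * Manifold.pathELength (𝓡 n) γ 0 1 := by
            rw [lintegral_const_mul' _ _ ENNReal.ofReal_ne_top,
              Manifold.pathELength_eq_lintegral_mfderivWithin_Icc]
        _ ≤ ENNReal.ofReal C * ENNReal.ofReal r := by gcongr
        _ = ENNReal.ofReal (C * r) := (ENNReal.ofReal_mul hC).symm
    rw [← ofReal_norm, ENNReal.ofReal_le_ofReal_iff (by positivity)] at h1
    simpa [hγ0, hγ1, norm_sub_rev] using h1
  refine le_of_forall_pos_le_add fun ε hε => ?_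
  have := key ((Manifold.riemannianEDist (𝓡 n) p q).toReal + ε / (C + 1))
    (lt_add_of_pos_right _ (by positivity))
  refine this.trans ?_
  rw [mul_add]
  gcongr
  rw [mul_div_assoc', div_le_iff₀ (by positivity)]
  nlinarith

variable [IsManifold (𝓡 n) ∞ M] {x : OpenPartialHomeomorph M (EuclideanSpace ℝ (Fin n))}
  [IsContMDiffRiemannianBundle (𝓡 n) ∞ (EuclideanSpace ℝ (Fin n))
    (fun p : M => TangentSpace (𝓡 n) p)]

/-- The preimage of a segment in the chart is a path of finite length. -/
theorem riemannianEDist_ne_top_of_segment_subset (hx : x ∈ IsManifold.maximalAtlas (𝓡 n) ∞ M)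
    {y z : EuclideanSpace ℝ (Fin n)} (h : segment ℝ y z ⊆ x.target) :
    Manifold.riemannianEDist (𝓡 n) (x.symm y) (x.symm z) ≠ ⊤ := by
  have hcomp : IsCompact (segment ℝ y z) := by
    rw [segment_eq_image_lineMap]
    exact isCompact_Icc.image (AffineMap.lineMap_continuous)
  obtain ⟨Λ, hΛ1, hΛ⟩ := exists_norm_chartSymmDeriv_le hx hcomp h
  set ℓ : ℝ → EuclideanSpace ℝ (Fin n) := fun t => y + t • (z - y) with hℓ
  have hℓd : ∀ t, HasDerivAt ℓ (z - y) t := fun t => by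
    have h1 := ((hasDerivAt_id t).smul_const (z - y)).const_add y
    rw [one_smul] at h1
    exact h1
  have hℓc : ContDiff ℝ 1 ℓ := by fun_prop
  have hmaps : MapsTo ℓ (Icc 0 1) (segment ℝ y z) := by
    intro t ht
    rw [segment_eq_image']
    exact ⟨t, ht, rfl⟩
  have hγ : ContMDiffOn 𝓘(ℝ, ℝ) (𝓡 n) 1 (x.symm ∘ ℓ) (Icc 0 1) :=
    ((contMDiffOn_symm_of_mem_maximalAtlas hx).of_le (by norm_cast)).comp
      hℓc.contMDiff.contMDiffOn fun t ht => h (hmaps ht)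
  refine ne_top_of_le_ne_top ?_ (Manifold.riemannianEDist_le_pathELength hγ
    (by simp [hℓ]) (by simp [hℓ]) zero_le_one)
  rw [Manifold.pathELength_eq_lintegral_mfderivWithin_Icc]
  refine ne_top_of_le_ne_top ?_ (setLIntegral_mono' (g := fun _ => ENNReal.ofReal (Λ * ‖z - y‖))
    measurableSet_Icc fun t ht => ?_)
  · rw [setLIntegral_const]
    exact ENNReal.mul_ne_top ENNReal.ofReal_ne_top (by simp)
  · have h1 : mfderivWithin 𝓘(ℝ, ℝ) (𝓡 n) (x.symm ∘ ℓ) (Icc 0 1) t =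
        (mfderiv (𝓡 n) (𝓡 n) x.symm (ℓ t)).comp
          (mfderivWithin 𝓘(ℝ, ℝ) (𝓡 n) ℓ (Icc 0 1) t) := by
      apply mfderiv_comp_mfderivWithin
      · exact (mdifferentiable_of_mem_maximalAtlas hx).mdifferentiableAt_symm (h (hmaps ht))
      · exact (hℓd t).differentiableAt.differentiableWithinAt.mdifferentiableWithinAt
      · rw [uniqueMDiffWithinAt_iff_uniqueDiffWithinAt]
        exact uniqueDiffOn_Icc zero_lt_one t ht
    have h2 : mfderivWithin 𝓘(ℝ, ℝ) (𝓡 n) ℓ (Icc 0 1) t 1 = z - y := by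
      rw [mfderivWithin_eq_fderivWithin,
        (hℓd t).hasFDerivAt.hasFDerivWithinAt.fderivWithin (uniqueDiffOn_Icc zero_lt_one t ht)]
      exact one_smul ℝ (z - y)
    have h3 : mfderivWithin 𝓘(ℝ, ℝ) (𝓡 n) (x.symm ∘ ℓ) (Icc 0 1) t 1 =
        chartSymmDeriv x (ℓ t) (z - y) := by
      rw [h1, ← h2]; rfl
    rw [h3, ← ofReal_norm]
    exact ENNReal.ofReal_le_ofReal (hΛ _ (hmaps ht) _).1

/-- On a compact set in the domain of a chart, the chart is Lipschitz for the Riemannian distance: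
cut off outside the compact set, it is a smooth map on all of `M` with bounded differential. -/
theorem exists_norm_chart_sub_le [T2Space M] [CompactSpace M]
    (hx : x ∈ IsManifold.maximalAtlas (𝓡 n) ∞ M)
    {L : Set M} (hL : IsCompact L) (hLx : L ⊆ x.source) :
    ∃ C : ℝ, 0 ≤ C ∧ ∀ p ∈ L, ∀ q ∈ L, Manifold.riemannianEDist (𝓡 n) p q ≠ ⊤ →
      ‖x p - x q‖ ≤ C * (Manifold.riemannianEDist (𝓡 n) p q).toReal := by
  have : NormalSpace M := inferInstance
  obtain ⟨χ, hχ0, hχ1, -⟩ := exists_contMDiffMap_zero_one_nhds_of_isClosed (n := (⊤ : ℕ∞)) (𝓡 n)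
    (s := x.sourceᶜ) (t := L) x.open_source.isClosed_compl hL.isClosed
    (disjoint_left.2 fun p hp hpL => hp (hLx hpL))
  have hsupp : tsupport χ ⊆ x.source := by
    intro p hp
    by_contra hps
    have h1 : ∀ᶠ q in 𝓝 p, χ q = 0 := hχ0.filter_mono (nhds_le_nhdsSet hps)
    exact (notMem_tsupport_iff_eventuallyEq.2 h1) hp
  have hcomp : IsCompact (x '' tsupport χ) :=
    (isClosed_tsupport χ).isCompact.image_of_continuousOn (x.continuousOn.mono hsupp)
  have hcompx : x '' tsupport χ ⊆ x.target := by
    rintro _ ⟨p, hp, rfl⟩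
    exact x.map_source (hsupp hp)
  obtain ⟨Λ, hΛ1, hΛ⟩ := exists_norm_chartSymmDeriv_le hx hcomp hcompx
  -- The cut-off chart is `f = χ • x`. On the domain of the chart it is `g ∘ x`, and there the bounds
  -- for `dg` and `dx` on the compact support of `χ` bound its differential.
  set g : EuclideanSpace ℝ (Fin n) → EuclideanSpace ℝ (Fin n) := fun y => χ (x.symm y) • y with hg
  have hgs : ContDiffOn ℝ ∞ g x.target := by
    have h1 : ContMDiffOn (𝓡 n) 𝓘(ℝ, ℝ) ∞ (χ ∘ x.symm) x.target :=
      χ.contMDiff.comp_contMDiffOn (contMDiffOn_symm_of_mem_maximalAtlas hx)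
    exact (contMDiffOn_iff_contDiffOn.1 h1).smul contDiffOn_id
  obtain ⟨B, hB⟩ := hcomp.exists_bound_of_continuousOn
    ((hgs.continuousOn_fderiv_of_isOpen x.open_target (by simp)).mono hcompx)
  set f : M → EuclideanSpace ℝ (Fin n) := fun p => χ p • x p with hf
  have hfs : ContMDiff (𝓡 n) 𝓘(ℝ, EuclideanSpace ℝ (Fin n)) ∞ f := by
    refine contMDiff_of_tsupport fun p hp => ?_
    have hp' : p ∈ x.source := hsupp (tsupport_smul_subset_left _ _ hp)
    exact (χ.contMDiff p).smul (contMDiffAt_of_mem_maximalAtlas hx hp')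
  have hbound : ∀ (p : M) (v : TangentSpace (𝓡 n) p),
      @norm (EuclideanSpace ℝ (Fin n)) _ (mfderiv (𝓡 n) 𝓘(ℝ, EuclideanSpace ℝ (Fin n)) f p v) ≤
        (max B 0 * Λ) * ‖v‖ := by
    intro p v
    by_cases hp : p ∈ tsupport χ
    · have hps := hsupp hp
      have h1 : f =ᶠ[𝓝 p] g ∘ x := by
        filter_upwards [x.open_source.mem_nhds hps] with q hq
        simp [hf, hg, x.left_inv hq]
      have hgd : DifferentiableAt ℝ g (x p) :=
        (hgs.contDiffAt (x.open_target.mem_nhds (x.map_source hps))).differentiableAt (by simp)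
      have h2 : mfderiv (𝓡 n) 𝓘(ℝ, EuclideanSpace ℝ (Fin n)) f p =
          (mfderiv (𝓡 n) 𝓘(ℝ, EuclideanSpace ℝ (Fin n)) g (x p)).comp
            (mfderiv (𝓡 n) (𝓡 n) x p) := by
        rw [h1.mfderiv_eq]
        exact mfderiv_comp p hgd.mdifferentiableAt
          ((mdifferentiable_of_mem_maximalAtlas hx).mdifferentiableAt hps)
      have h3 : mfderiv (𝓡 n) 𝓘(ℝ, EuclideanSpace ℝ (Fin n)) f p v =
          fderiv ℝ g (x p) (chartDeriv x p v) := by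
        rw [h2, mfderiv_eq_fderiv]
        rfl
      have h4 : ‖chartDeriv x p v‖ ≤ Λ * ‖v‖ := by
        obtain ⟨y, hy, rfl⟩ : ∃ y ∈ x.target, x.symm y = p :=
          ⟨x p, x.map_source hps, x.left_inv hps⟩
        have h5 := (hΛ y ⟨x.symm y, hp, x.right_inv hy⟩ (chartDeriv x (x.symm y) v)).2
        rwa [chartSymmDeriv_chartDeriv hx hy] at h5
      rw [h3]
      calc ‖fderiv ℝ g (x p) (chartDeriv x p v)‖
          ≤ ‖fderiv ℝ g (x p)‖ * ‖chartDeriv x p v‖ := ContinuousLinearMap.le_opNorm _ _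
        _ ≤ max B 0 * (Λ * ‖v‖) := by
            gcongr
            exact (hB _ ⟨p, hp, rfl⟩).trans (le_max_left _ _)
        _ = _ := by ring
    · have h1 : f =ᶠ[𝓝 p] fun _ => 0 := by
        filter_upwards [notMem_tsupport_iff_eventuallyEq.1 hp] with q hq
        simp [hf, hq]
      rw [h1.mfderiv_eq, mfderiv_const]
      have : (0 : ℝ) ≤ max B 0 * Λ * ‖v‖ :=
        mul_nonneg (mul_nonneg (le_max_right _ _) (by linarith)) (norm_nonneg _)
      exact (norm_zero (E := EuclideanSpace ℝ (Fin n))).trans_le this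
  refine ⟨max B 0 * Λ, mul_nonneg (le_max_right _ _) (by linarith), fun p hp q hq hpq => ?_⟩
  have h1 := norm_sub_le_mul_riemannianEDist (hfs.of_le (by norm_cast))
    (mul_nonneg (le_max_right B 0) (by linarith)) hbound p q hpq
  have hχ : ∀ p ∈ L, χ p = 1 := fun p hp =>
    hχ1.self_of_nhdsSet p hp
  simpa only [hf, hχ p hp, hχ q hq, one_smul] using h1

end Distance

/-! ### Straight simplices in a chart -/

section Forms

variable {n : ℕ} {M : Type*} [TopologicalSpace M] [ChartedSpace (EuclideanSpace ℝ (Fin n)) M]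
  {x : OpenPartialHomeomorph M (EuclideanSpace ℝ (Fin n))}

/-- A form is the pullback under the chart of its coordinate expression. -/
theorem apply_eq_coordRep (hx : x ∈ IsManifold.maximalAtlas (𝓡 n) ∞ M) {j : ℕ}
    (α : (p : M) → TangentSpace (𝓡 n) p [⋀^Fin j]→L[ℝ] ℝ) {p : M} (hp : p ∈ x.source)
    (v : Fin j → TangentSpace (𝓡 n) p) :
    α p v = coordRep x α (x p) fun i => chartDeriv x p (v i) := by
  obtain ⟨y, hy, rfl⟩ : ∃ y ∈ x.target, x.symm y = p := ⟨x p, x.map_source hp, x.left_inv hp⟩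
  rw [x.right_inv hy]
  have h : α (x.symm y) (fun i => chartSymmDeriv x y (chartDeriv x (x.symm y) (v i))) =
      α (x.symm y) v := by simp only [chartSymmDeriv_chartDeriv hx hy]
  exact h.symm

end Forms

section Straight

open Set Filter Topology MeasureTheory

variable {V : Type*} [Fintype V]

theorem Simplex.carrier_mono {C : AbstractSimplicialComplex V} {m n : ℕ} {τ : Simplex C m}
    {σ : Simplex C n} (h : τ.1 ⊆ σ.1) : τ.carrier ⊆ σ.carrier :=
  fun _ ht => ⟨ht.1, fun v hv => ht.2 v fun hvτ => hv (h hvτ)⟩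

variable [LinearOrder V]

theorem Simplex.carrier_subset_realization {C : AbstractSimplicialComplex V} {m : ℕ}
    (τ : Simplex C m) : τ.carrier ⊆ realization C := by
  intro t ht
  refine ⟨ht.1, (C.isRelLowerSet_faces τ.2.1).2 (fun v hv => ?_) ?_⟩
  · by_contra hvτ
    exact (Finset.mem_filter.1 hv).2 (ht.2 v hvτ)
  · by_contra hne
    rw [Finset.not_nonempty_iff_eq_empty, Finset.filter_eq_empty_iff] at hne
    have h0 : ∑ v, t v = 0 := Finset.sum_eq_zero fun v hv => not_not.1 (hne hv)
    rw [ht.1.2] at h0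
    exact one_ne_zero h0

theorem Simplex.single_mem_carrier {C : AbstractSimplicialComplex V} {m : ℕ}
    (τ : Simplex C m) {v : V} (hv : v ∈ τ.1) : (Pi.single v 1 : V → ℝ) ∈ τ.carrier :=
  ⟨single_mem_stdSimplex ℝ v, fun w hw => Pi.single_eq_of_ne (fun h : w = v => hw (h ▸ hv)) 1⟩

theorem Simplex.exists_incl_eq {C : AbstractSimplicialComplex V} {m : ℕ} (τ : Simplex C m)
    {s : V → ℝ} (hs : s ∈ τ.carrier) : ∃ t ∈ corner m, τ.incl t = s := by
  have hsum : ∑ i, s (τ.vert i) = 1 := by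
    rw [τ.sum_vert s, ← hs.1.2]
    exact Finset.sum_subset (Finset.subset_univ _) fun v _ hv => hs.2 v hv
  rw [Fin.sum_univ_succ] at hsum
  refine ⟨fun i => s (τ.vert i.succ), ⟨fun i => hs.1.1 _, ?_⟩, ?_⟩
  · linarith [hs.1.1 (τ.vert 0)]
  · ext v
    by_cases hv : v ∈ τ.1
    · obtain ⟨i, rfl⟩ := τ.exists_vert_eq hv
      rw [τ.incl_vert]
      refine Fin.cases ?_ (fun i => ?_) i
      · simp only [cornerBary, Fin.cons_zero]
        linarith
      · simp [cornerBary]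
    · rw [τ.incl_of_notMem _ hv, hs.2 v hv]

variable {n : ℕ} {M : Type*} [TopologicalSpace M] [ChartedSpace (EuclideanSpace ℝ (Fin n)) M]
  {K : SmoothTriangulation n M V} {x : OpenPartialHomeomorph M (EuclideanSpace ℝ (Fin n))}
  {σ : Simplex K.complex n}

namespace SmoothTriangulation

variable (K x) in
/-- The positions of the vertices in a chart. -/
def vertexCoord (v : V) : EuclideanSpace ℝ (Fin n) := x (K.vertex v)

theorem param_mem_cell {j : ℕ} {τ : Simplex K.complex j} (hτ : τ.1 ⊆ σ.1) {t : Fin j → ℝ}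
    (ht : t ∈ corner j) : K.param τ t ∈ K.cell σ :=
  ⟨τ.incl t, Simplex.carrier_mono hτ (τ.incl_mem_carrier ht), rfl⟩

theorem vertex_mem_cell {v : V} (hv : v ∈ σ.1) : K.vertex v ∈ K.cell σ :=
  ⟨_, σ.single_mem_carrier hv, rfl⟩

theorem exists_param_eq {p : M} (hp : p ∈ K.cell σ) : ∃ t ∈ corner n, K.param σ t = p := by
  obtain ⟨s, hs, rfl⟩ := hp
  obtain ⟨t, ht, rfl⟩ := σ.exists_incl_eq hs
  exact ⟨t, ht, rfl⟩

/-- In the chart, the faces of a straight simplex are parametrized by affine maps. -/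
theorem IsStraight.chart_param (h : K.IsStraight x σ) {j : ℕ} {τ : Simplex K.complex j}
    (hτ : τ.1 ⊆ σ.1) {t : Fin j → ℝ} (ht : t ∈ corner j) :
    x (K.param τ t) = K.vertexCoord x (τ.vert 0) + ∑ i, t i • τ.edge (K.vertexCoord x) i := by
  have h1 := h (τ.incl t) (Simplex.carrier_mono hτ (τ.incl_mem_carrier ht))
  rw [param, h1]
  have h2 : ∑ v ∈ σ.1, τ.incl t v • x (K.vertex v) = ∑ v, τ.incl t v • K.vertexCoord x v :=
    Finset.sum_subset (Finset.subset_univ _) fun v _ hv => by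
      rw [τ.incl_of_notMem t fun hvτ => hv (hτ hvτ), zero_smul]
  rw [h2, τ.sum_incl_smul, sum_cornerBary_smul]
  rfl

/-- In the chart the tangent vectors of a face of a straight simplex are its edge vectors. -/
theorem IsStraight.chartDeriv_tangent (h : K.IsStraight x σ)
    (hx : x ∈ IsManifold.maximalAtlas (𝓡 n) ∞ M) (hσ : K.cell σ ⊆ x.source) {j : ℕ}
    {τ : Simplex K.complex j} (hτ : τ.1 ⊆ σ.1) {t : Fin j → ℝ} (ht : t ∈ corner j) (i : Fin j) :
    chartDeriv x (K.param τ t) (K.tangent τ t i) = τ.edge (K.vertexCoord x) i := by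
  set A : (Fin j → ℝ) →L[ℝ] EuclideanSpace ℝ (Fin n) :=
    ∑ i, (ContinuousLinearMap.proj i : (Fin j → ℝ) →L[ℝ] ℝ).smulRight
      (τ.edge (K.vertexCoord x) i) with hA
  have hAi : ∀ t, A t = ∑ i, t i • τ.edge (K.vertexCoord x) i := by
    intro t; simp [hA]
  have hu : UniqueMDiffWithinAt 𝓘(ℝ, Fin j → ℝ) (corner j) t :=
    (uniqueDiffOn_corner j t ht).uniqueMDiffWithinAt
  have h1 : mfderivWithin 𝓘(ℝ, Fin j → ℝ) (𝓡 n) (x ∘ K.param τ) (corner j) t =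
      (mfderiv (𝓡 n) (𝓡 n) x (K.param τ t)).comp
        (mfderivWithin 𝓘(ℝ, Fin j → ℝ) (𝓡 n) (K.param τ) (corner j) t) :=
    mfderiv_comp_mfderivWithin _
      ((mdifferentiable_of_mem_maximalAtlas hx).mdifferentiableAt (hσ (param_mem_cell hτ ht)))
      ((K.smooth j τ).mdifferentiableOn (by simp) t ht) hu
  have h2 : mfderivWithin 𝓘(ℝ, Fin j → ℝ) (𝓡 n) (x ∘ K.param τ) (corner j) t = A := by
    have h3 : ∀ s ∈ corner j, (x ∘ K.param τ) s = K.vertexCoord x (τ.vert 0) + A s := fun s hs => by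
      rw [hAi]; exact h.chart_param hτ hs
    rw [mfderivWithin_congr h3 (h3 t ht), mfderivWithin_eq_fderivWithin,
      fderivWithin_const_add, A.fderivWithin (uniqueDiffOn_corner j t ht)]
  have h3 : chartDeriv x (K.param τ t) (K.tangent τ t i) = A (Pi.single i 1) := by
    rw [← h2, h1]; rfl
  rw [h3, hAi, Finset.sum_eq_single i] <;> simp +contextual

/-- The integral of a form over a face of a straight simplex, in the chart. -/
theorem IsStraight.deRham_eq (h : K.IsStraight x σ)
    (hx : x ∈ IsManifold.maximalAtlas (𝓡 n) ∞ M) (hσ : K.cell σ ⊆ x.source) (α : DiffForm n M)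
    {j : ℕ} {τ : Simplex K.complex j} (hτ : τ.1 ⊆ σ.1) :
    K.deRham α j τ = ∫ t in corner j,
      coordRep x (α.toFun j) (x (K.param τ t)) (τ.edge (K.vertexCoord x)) := by
  refine setIntegral_congr_fun (isClosed_corner j).measurableSet fun t ht => ?_
  rw [apply_eq_coordRep hx _ (hσ (param_mem_cell hτ ht))]
  simp only [h.chartDeriv_tangent hx hσ hτ ht]

theorem IsStraight.segment_subset (h : K.IsStraight x σ) {p q : M} (hp : p ∈ K.cell σ)
    (hq : q ∈ K.cell σ) : segment ℝ (x p) (x q) ⊆ x '' K.cell σ := by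
  obtain ⟨s, hs, rfl⟩ := hp
  obtain ⟨t, ht, rfl⟩ := hq
  rintro _ ⟨a, b, ha, hb, hab, rfl⟩
  have hmem : a • s + b • t ∈ σ.carrier := by
    refine ⟨convex_stdSimplex ℝ V hs.1 ht.1 ha hb hab, fun v hv => ?_⟩
    simp [hs.2 v hv, ht.2 v hv]
  refine ⟨_, ⟨_, hmem, rfl⟩, ?_⟩
  rw [h _ hmem, h _ hs, h _ ht]
  simp only [Pi.add_apply, Pi.smul_apply, smul_eq_mul, add_smul, Finset.sum_add_distrib, mul_smul,
    Finset.smul_sum]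

theorem IsStraight.convex_image (h : K.IsStraight x σ) : Convex ℝ (x '' K.cell σ) := by
  rw [convex_iff_segment_subset]
  rintro _ ⟨p, hp, rfl⟩ _ ⟨q, hq, rfl⟩
  exact h.segment_subset hp hq

theorem cell_isCompact : IsCompact (K.cell σ) := by
  have h1 : IsCompact σ.carrier := by
    have h2 : σ.carrier = stdSimplex ℝ V ∩ ⋂ v ∈ {v | v ∉ σ.1}, {t : V → ℝ | t v = 0} := by
      ext t; simp [Simplex.carrier]
    rw [h2]
    refine (isCompact_stdSimplex ℝ V).inter_right (isClosed_biInter fun v _ => ?_)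
    exact isClosed_eq (continuous_apply v) continuous_const
  exact h1.image_of_continuousOn (K.continuousOn_map.mono σ.carrier_subset_realization)

/-- In the chart the diameter of a straight simplex is the length of its longest edge. -/
theorem IsStraight.norm_sub_le (h : K.IsStraight x σ) {d : ℝ}
    (hd : ∀ v ∈ σ.1, ∀ w ∈ σ.1, ‖K.vertexCoord x v - K.vertexCoord x w‖ ≤ d) {p q : M}
    (hp : p ∈ K.cell σ) (hq : q ∈ K.cell σ) : ‖x p - x q‖ ≤ d := by
  obtain ⟨s, hs, rfl⟩ := hp
  obtain ⟨t, ht, rfl⟩ := hq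
  have hsum : ∀ {s : V → ℝ}, s ∈ σ.carrier → ∑ v ∈ σ.1, s v = 1 := fun {s} hs => by
    rw [← hs.1.2]
    exact Finset.sum_subset (Finset.subset_univ _) fun v _ hv => hs.2 v hv
  have hpt : ∀ {s : V → ℝ}, s ∈ σ.carrier → ∀ c, (∀ v ∈ σ.1, ‖c - K.vertexCoord x v‖ ≤ d) →
      ‖c - x (K.map s)‖ ≤ d := fun {s} hs c hc => by
    have h1 : c - x (K.map s) = ∑ v ∈ σ.1, s v • (c - K.vertexCoord x v) := by
      simp only [smul_sub, Finset.sum_sub_distrib, ← Finset.sum_smul]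
      rw [hsum hs, one_smul, h s hs]
      rfl
    rw [h1]
    calc _ ≤ ∑ v ∈ σ.1, s v * d := by
          refine (norm_sum_le _ _).trans (Finset.sum_le_sum fun v hv => ?_)
          rw [norm_smul, Real.norm_of_nonneg (hs.1.1 v)]
          exact mul_le_mul_of_nonneg_left (hc v hv) (hs.1.1 v)
      _ = d := by rw [← Finset.sum_mul, hsum hs, one_mul]
  refine hpt ht _ fun v hv => ?_
  rw [norm_sub_rev]
  refine hpt hs _ fun w hw => ?_
  exact hd v hv w hw

end SmoothTriangulation

end Straight

/-! ### Barycentric coordinates of an affine simplex -/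

section Inverse

variable {n : ℕ}

/-- A crude form of Hadamard's inequality. -/
theorem abs_det_le_factorial_mul_prod (A : Matrix (Fin n) (Fin n) ℝ) (c : Fin n → ℝ)
    (h : ∀ a k, |A a k| ≤ c k) : |A.det| ≤ n.factorial * ∏ k, c k := by
  rw [Matrix.det_apply']
  refine (Finset.abs_sum_le_sum_abs _ _).trans ?_
  have key : ∀ s : Equiv.Perm (Fin n), |((Equiv.Perm.sign s : ℤ) : ℝ) * ∏ i, A (s i) i| ≤
      ∏ k, c k := by
    intro s
    have hs : |((Equiv.Perm.sign s : ℤ) : ℝ)| = 1 := by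
      rcases Int.units_eq_one_or (Equiv.Perm.sign s) with h1 | h1 <;> simp [h1]
    rw [abs_mul, hs, one_mul, Finset.abs_prod]
    exact Finset.prod_le_prod (fun _ _ => abs_nonneg _) fun i _ => h _ _
  refine (Finset.sum_le_sum fun s _ => key s).trans ?_
  simp [Fintype.card_perm]

/-- The matrix whose columns are the vectors `e_i`. -/
def columnMatrix (e : Fin n → EuclideanSpace ℝ (Fin n)) : Matrix (Fin n) (Fin n) ℝ :=
  Matrix.of fun a i => e i a

theorem columnMatrix_mulVec (e : Fin n → EuclideanSpace ℝ (Fin n)) (c : Fin n → ℝ) (a : Fin n) :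
    (columnMatrix e).mulVec c a = (∑ i, c i • e i) a := by
  simp [columnMatrix, Matrix.mulVec, dotProduct, mul_comm]

/-- The coordinates with respect to the basis `e`, given by Cramer's rule. -/
noncomputable def coordsOf (e : Fin n → EuclideanSpace ℝ (Fin n)) :
    EuclideanSpace ℝ (Fin n) →ₗ[ℝ] Fin n → ℝ :=
  (columnMatrix e).det⁻¹ • (columnMatrix e).cramer ∘ₗ
    (WithLp.linearEquiv 2 ℝ (Fin n → ℝ)).toLinearMap

variable {e : Fin n → EuclideanSpace ℝ (Fin n)}

theorem sum_coordsOf_smul (he : (columnMatrix e).det ≠ 0) (u : EuclideanSpace ℝ (Fin n)) :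
    ∑ i, coordsOf e u i • e i = u := by
  ext a
  rw [← columnMatrix_mulVec]
  simp only [coordsOf, LinearMap.smul_apply, LinearMap.comp_apply, Matrix.mulVec_smul,
    Matrix.mulVec_cramer]
  simp [he]

theorem coordsOf_sum_smul (he : (columnMatrix e).det ≠ 0) (c : Fin n → ℝ) :
    coordsOf e (∑ i, c i • e i) = c := by
  have h1 := sum_coordsOf_smul he (∑ i, c i • e i)
  rw [← sub_eq_zero]
  refine Matrix.eq_zero_of_mulVec_eq_zero he ?_
  ext a
  rw [columnMatrix_mulVec]
  simp only [Pi.sub_apply, sub_smul, Finset.sum_sub_distrib, h1, sub_self]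
  rfl

/-- Cramer's rule: the numerator is a determinant with one column `u` and `n - 1` columns from
`e`. -/
theorem abs_coordsOf_le {d : ℝ} (hd : ∀ i, ‖e i‖ ≤ d) (u : EuclideanSpace ℝ (Fin n)) (i : Fin n) :
    |coordsOf e u i| ≤ |(columnMatrix e).det|⁻¹ * (n.factorial * d ^ (n - 1)) * ‖u‖ := by
  have h1 : coordsOf e u i = (columnMatrix e).det⁻¹ * ((columnMatrix e).updateCol i u).det := by
    simp [coordsOf, Matrix.cramer_apply]
  have h2 : |((columnMatrix e).updateCol i u).det| ≤
      n.factorial * ∏ k, Function.update (fun _ => d) i ‖u‖ k := by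
    refine abs_det_le_factorial_mul_prod _ _ fun a k => ?_
    rcases eq_or_ne k i with rfl | hk
    · simpa using PiLp.norm_apply_le u a
    · simpa [hk, columnMatrix] using (PiLp.norm_apply_le (e k) a).trans (hd k)
  rw [Finset.prod_update_of_mem (Finset.mem_univ i)] at h2
  simp only [Finset.prod_const, Finset.card_sdiff, Finset.card_univ, Fintype.card_fin,
    Finset.inter_univ, Finset.card_singleton] at h2
  rw [h1, abs_mul, abs_inv]
  calc _ ≤ |(columnMatrix e).det|⁻¹ * (n.factorial * (‖u‖ * d ^ (n - 1))) := by gcongr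
    _ = _ := by ring

/-- The volume of the parallelepiped spanned by the images of vectors under a linear map that
stretches lengths at most by the factor `Λ`. -/
theorem sqrt_gram_det_map_le {T : Type*} [NormedAddCommGroup T] [InnerProductSpace ℝ T]
    (f : EuclideanSpace ℝ (Fin n) →ₗ[ℝ] T) {Λ : ℝ} (hΛ : ∀ u, ‖f u‖ ≤ Λ * ‖u‖)
    (e : Fin n → EuclideanSpace ℝ (Fin n)) :
    √(Matrix.of fun i k => inner ℝ (f (e i)) (f (e k))).det ≤
      √(n.factorial * (Λ ^ 2) ^ n) * |(columnMatrix e).det| := by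
  -- The Gram matrix of the images is `Eᵀ G E`, where `G` is the Gram matrix of the images of the
  -- standard basis and `E` the matrix of the vectors.
  set G : Matrix (Fin n) (Fin n) ℝ := Matrix.of fun a b =>
    inner ℝ (f (EuclideanSpace.single a 1)) (f (EuclideanSpace.single b 1)) with hG
  have hexp : ∀ u : EuclideanSpace ℝ (Fin n), f u = ∑ a, u a • f (EuclideanSpace.single a 1) := by
    intro u
    conv_lhs => rw [← (EuclideanSpace.basisFun (Fin n) ℝ).sum_repr u]
    simp [map_sum]
  have hgram : (Matrix.of fun i k => inner ℝ (f (e i)) (f (e k))) =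
      (columnMatrix e).transpose * G * columnMatrix e := by
    ext i k
    simp only [Matrix.of_apply, Matrix.mul_apply, Matrix.transpose_apply, columnMatrix, hG]
    rw [hexp (e i), hexp (e k), inner_sum]
    refine Finset.sum_congr rfl fun b _ => ?_
    rw [sum_inner, Finset.sum_mul]
    refine Finset.sum_congr rfl fun a _ => ?_
    rw [real_inner_smul_left, real_inner_smul_right]
    ring
  have hGdet : |G.det| ≤ n.factorial * (Λ ^ 2) ^ n := by
    have := abs_det_le_factorial_mul_prod G (fun _ => Λ ^ 2) fun a b => by
      refine (abs_real_inner_le_norm _ _).trans ?_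
      have h1 := hΛ (EuclideanSpace.single a 1)
      have h2 := hΛ (EuclideanSpace.single b 1)
      simp only [PiLp.norm_single, norm_one, mul_one] at h1 h2
      rw [sq]
      exact mul_le_mul h1 h2 (norm_nonneg _) ((norm_nonneg _).trans h1)
    simpa using this
  rw [hgram, Matrix.det_mul, Matrix.det_mul, Matrix.det_transpose]
  calc √((columnMatrix e).det * G.det * (columnMatrix e).det)
      = √(G.det * (columnMatrix e).det ^ 2) := by congr 1; ring
    _ ≤ √((n.factorial * (Λ ^ 2) ^ n) * (columnMatrix e).det ^ 2) := by
        gcongr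
        exact (le_abs_self _).trans hGdet
    _ = _ := by rw [Real.sqrt_mul (by positivity), Real.sqrt_sq_eq_abs]

end Inverse

section Geometry

open Set Filter Topology MeasureTheory

variable {V : Type*} [Fintype V] [LinearOrder V]
variable {n : ℕ} {M : Type*} [TopologicalSpace M] [ChartedSpace (EuclideanSpace ℝ (Fin n)) M]
  {K : SmoothTriangulation n M V} {x : OpenPartialHomeomorph M (EuclideanSpace ℝ (Fin n))}
  {σ : Simplex K.complex n}

namespace SmoothTriangulation

/-- In the chart, a point of a straight simplex has the standard coordinates given by Cramer's
rule. -/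
theorem IsStraight.coordsOf_chart_param (h : K.IsStraight x σ)
    (hdet : (columnMatrix (σ.edge (K.vertexCoord x))).det ≠ 0) {t : Fin n → ℝ} (ht : t ∈ corner n) :
    coordsOf (σ.edge (K.vertexCoord x)) (x (K.param σ t) - K.vertexCoord x (σ.vert 0)) = t := by
  rw [h.chart_param subset_rfl ht, add_sub_cancel_left, coordsOf_sum_smul hdet]

/-- In the chart, a nondegenerate straight simplex is a convex set with interior points, being the
preimage of the standard simplex under an affine isomorphism. -/
theorem IsStraight.uniqueMDiffWithinAt_cell (h : K.IsStraight x σ)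
    (hx : x ∈ IsManifold.maximalAtlas (𝓡 n) ∞ M) (hσ : K.cell σ ⊆ x.source)
    (hdet : (columnMatrix (σ.edge (K.vertexCoord x))).det ≠ 0) {p : M} (hp : p ∈ K.cell σ) :
    UniqueMDiffWithinAt (𝓡 n) (K.cell σ) p := by
  set B := coordsOf (σ.edge (K.vertexCoord x)) with hB
  set P₀ := K.vertexCoord x (σ.vert 0) with hP
  have hBc : Continuous B := LinearMap.continuous_of_finiteDimensional _
  set S : Set (EuclideanSpace ℝ (Fin n)) := (fun y => B (y - P₀)) ⁻¹' corner n with hS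
  have hSc : Convex ℝ S := by
    intro y hy z hz a b ha hb hab
    have h1 : a • y + b • z - P₀ = a • (y - P₀) + b • (z - P₀) := by
      have : P₀ = (a + b) • P₀ := by rw [hab, one_smul]
      conv_lhs => rw [this]
      module
    simp only [hS, mem_preimage, h1, map_add, map_smul]
    exact convex_corner n hy hz ha hb hab
  have hSi : (interior S).Nonempty := by
    obtain ⟨t, ht⟩ := interior_corner_nonempty n
    have hcont : Continuous fun y => B (y - P₀) := hBc.comp (continuous_id.sub continuous_const)
    refine ⟨P₀ + ∑ i, t i • σ.edge (K.vertexCoord x) i,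
      preimage_interior_subset_interior_preimage hcont ?_⟩
    rw [mem_preimage, add_sub_cancel_left, hB, coordsOf_sum_smul hdet]
    exact ht
  have hu := (uniqueDiffOn_convex hSc hSi).uniqueMDiffOn.uniqueMDiffOn_preimage
    (mdifferentiable_of_mem_maximalAtlas hx).symm
  have hcell : x.symm.target ∩ x.symm.symm ⁻¹' S = K.cell σ := by
    rw [x.symm_symm, x.symm_target]
    ext q
    constructor
    · rintro ⟨hq, hqS⟩
      have h1 := h.chart_param (τ := σ) subset_rfl hqS
      simp only [hB] at h1
      rw [sum_coordsOf_smul hdet, hP, add_sub_cancel] at h1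
      have h2 := x.injOn (hσ (param_mem_cell (σ := σ) subset_rfl hqS)) hq h1
      rw [← h2]
      exact param_mem_cell (σ := σ) subset_rfl hqS
    · intro hq
      refine ⟨hσ hq, ?_⟩
      obtain ⟨t, ht, rfl⟩ := exists_param_eq hq
      simp only [hS, mem_preimage, hB, hP]
      rwa [h.coordsOf_chart_param hdet ht]
  rw [hcell] at hu
  exact hu p hp

/-- The differentials of the barycentric coordinates of a straight simplex. -/
theorem IsStraight.mfderivWithin_bary (h : K.IsStraight x σ)
    (hx : x ∈ IsManifold.maximalAtlas (𝓡 n) ∞ M) (hσ : K.cell σ ⊆ x.source)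
    (hdet : (columnMatrix (σ.edge (K.vertexCoord x))).det ≠ 0) {p : M} (hp : p ∈ K.cell σ) (v : V) :
    (mfderivWithin (𝓡 n) 𝓘(ℝ, ℝ) (fun q => K.bary q v) (K.cell σ) p).toLinearMap =
      (σ.inclDeriv v ∘ₗ coordsOf (σ.edge (K.vertexCoord x))) ∘ₗ
        (chartDeriv x p).toLinearMap := by
  set D : EuclideanSpace ℝ (Fin n) →L[ℝ] ℝ := LinearMap.toContinuousLinearMap
    (σ.inclDeriv v ∘ₗ coordsOf (σ.edge (K.vertexCoord x))) with hD
  set c : ℝ := (Pi.single (σ.vert 0) 1 : V → ℝ) v - D (K.vertexCoord x (σ.vert 0)) with hc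
  -- On the simplex the barycentric coordinate is the affine function `c + D` of the chart.
  have hbary : ∀ q ∈ K.cell σ, K.bary q v = ((fun y => c + D y) ∘ x) q := by
    intro q hq
    obtain ⟨t, ht, rfl⟩ := exists_param_eq hq
    have h1 : K.bary (K.param σ t) = σ.incl t :=
      K.bary_map _ (σ.carrier_subset_realization (σ.incl_mem_carrier ht))
    have h2 : D (x (K.param σ t) - K.vertexCoord x (σ.vert 0)) = σ.inclDeriv v t := by
      simp only [hD, LinearMap.coe_toContinuousLinearMap', LinearMap.comp_apply]
      rw [h.coordsOf_chart_param hdet ht]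
    rw [map_sub] at h2
    rw [h1, σ.incl_eq]
    simp only [Function.comp_apply, hc]
    linarith
  have hu := h.uniqueMDiffWithinAt_cell hx hσ hdet hp
  have hxd := (mdifferentiable_of_mem_maximalAtlas hx).mdifferentiableAt (hσ hp)
  have hDd : HasFDerivAt (fun y => c + D y) D (x p) := D.hasFDerivAt.const_add c
  have hcomp : HasMFDerivAt (𝓡 n) 𝓘(ℝ, ℝ) ((fun y => c + D y) ∘ x) p
      (D.comp (mfderiv (𝓡 n) (𝓡 n) x p)) := hDd.hasMFDerivAt.comp p hxd.hasMFDerivAt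
  rw [mfderivWithin_congr hbary (hbary p hp), hcomp.hasMFDerivWithinAt.mfderivWithin hu]
  rfl

theorem bary_of_notMem {p : M} (hp : p ∈ K.cell σ) {v : V} (hv : v ∉ σ.1) : K.bary p v = 0 := by
  obtain ⟨s, hs, rfl⟩ := hp
  rw [K.bary_map _ (σ.carrier_subset_realization hs)]
  exact hs.2 v hv

theorem abs_bary_le (p : M) (v : V) : |K.bary p v| ≤ 1 := by
  have h := (K.bary_mem p).1
  rw [abs_of_nonneg (h.1 v), ← h.2]
  exact Finset.single_le_sum (fun v _ => h.1 v) (Finset.mem_univ v)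

section Metric

variable [Bundle.RiemannianBundle (fun p : M => TangentSpace (𝓡 n) p)]

/-- The Riemannian volume of a parallelepiped in terms of its Euclidean volume in the chart. -/
theorem sqrt_gram_det_le (hx : x ∈ IsManifold.maximalAtlas (𝓡 n) ∞ M) {p : M} (hp : p ∈ x.source)
    {Λ : ℝ} (hΛ : ∀ v : TangentSpace (𝓡 n) p, ‖v‖ ≤ Λ * ‖chartDeriv x p v‖)
    {e : Fin n → EuclideanSpace ℝ (Fin n)} (w : Fin n → TangentSpace (𝓡 n) p)
    (hw : ∀ i, chartDeriv x p (w i) = e i) :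
    √(Matrix.of fun i k => inner ℝ (w i) (w k)).det ≤
      √(n.factorial * (Λ ^ 2) ^ n) * |(columnMatrix e).det| := by
  obtain ⟨y, hy, rfl⟩ : ∃ y ∈ x.target, x.symm y = p := ⟨x p, x.map_source hp, x.left_inv hp⟩
  have hw' : w = fun i => (chartSymmDeriv x y).toLinearMap (e i) := by
    ext1 i
    rw [← hw i]
    exact (chartSymmDeriv_chartDeriv hx hy (w i)).symm
  rw [hw']
  refine sqrt_gram_det_map_le (chartSymmDeriv x y).toLinearMap (fun u => ?_) e
  have := hΛ (chartSymmDeriv x y u)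
  rwa [chartDeriv_chartSymmDeriv hx hy] at this

/-- The volume of a straight simplex in terms of its Euclidean volume in the chart. -/
theorem IsStraight.vol_le (h : K.IsStraight x σ)
    (hx : x ∈ IsManifold.maximalAtlas (𝓡 n) ∞ M) (hσ : K.cell σ ⊆ x.source) {Λ : ℝ}
    (hΛ : ∀ p ∈ K.cell σ, ∀ v : TangentSpace (𝓡 n) p, ‖v‖ ≤ Λ * ‖chartDeriv x p v‖) :
    K.vol σ ≤ √(n.factorial * (Λ ^ 2) ^ n) *
      |(columnMatrix (σ.edge (K.vertexCoord x))).det| := by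
  set C := √(n.factorial * (Λ ^ 2) ^ n) * |(columnMatrix (σ.edge (K.vertexCoord x))).det| with hC
  have hC0 : 0 ≤ C := by positivity
  refine (Real.le_norm_self _).trans ((norm_setIntegral_le_of_norm_le_const (C := C)
    (volume_corner_lt_top n) fun t ht => ?_).trans ?_)
  · rw [Real.norm_of_nonneg (Real.sqrt_nonneg _)]
    have hmem : K.param σ t ∈ K.cell σ := param_mem_cell (σ := σ) subset_rfl ht
    exact sqrt_gram_det_le hx (hσ hmem) (hΛ _ hmem) _ fun i =>
      h.chartDeriv_tangent hx hσ subset_rfl ht i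
  · rw [volume_real_corner]
    exact mul_le_of_le_one_right hC0
      (inv_le_one_of_one_le₀ (by exact_mod_cast Nat.succ_le_of_lt n.factorial_pos))

theorem mesh_nonneg : 0 ≤ K.mesh := Real.iSup_nonneg fun _ => ENNReal.toReal_nonneg

/-- A degenerate mesh is excluded by the fullness: division by zero would give the quotient zero. -/
theorem mesh_pow_pos {Θ₀ : ℝ} (hΘ₀ : 0 < Θ₀) (hK : Θ₀ ≤ K.fullness) (σ : Simplex K.complex n) :
    0 < K.mesh ^ n := by
  have h1 : Θ₀ ≤ K.vol σ / K.mesh ^ n := hK.trans (ciInf_le (Set.finite_range _).bddBelow σ)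
  refine (pow_nonneg mesh_nonneg n).lt_of_ne' fun h0 => ?_
  rw [h0, div_zero] at h1
  exact absurd h1 (not_le.2 hΘ₀)

theorem mul_mesh_pow_le_vol {Θ₀ : ℝ} (hΘ₀ : 0 < Θ₀) (hK : Θ₀ ≤ K.fullness)
    (σ : Simplex K.complex n) : Θ₀ * K.mesh ^ n ≤ K.vol σ := by
  have h1 : Θ₀ ≤ K.vol σ / K.mesh ^ n := hK.trans (ciInf_le (Set.finite_range _).bddBelow σ)
  rwa [le_div_iff₀ (mesh_pow_pos hΘ₀ hK σ)] at h1

theorem toReal_riemannianEDist_le_mesh {v w : V} (hv : v ∈ σ.1) (hw : w ∈ σ.1) (hvw : v ≠ w) :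
    (Manifold.riemannianEDist (𝓡 n) (K.vertex v) (K.vertex w)).toReal ≤ K.mesh := by
  have hface : ({v, w} : Finset V) ∈ K.complex.faces := by
    refine (K.complex.isRelLowerSet_faces σ.2.1).2 ?_ ⟨v, by simp⟩
    intro u hu
    rcases Finset.mem_insert.1 hu with rfl | hu
    · exact hv
    · rw [Finset.mem_singleton.1 hu]; exact hw
  exact le_ciSup (f := fun e : {e : V × V // e.1 ≠ e.2 ∧ {e.1, e.2} ∈ K.complex.faces} =>
    (Manifold.riemannianEDist (𝓡 n) (K.vertex e.1.1) (K.vertex e.1.2)).toReal)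
    (Set.finite_range _).bddAbove ⟨(v, w), hvw, hface⟩

variable [IsManifold (𝓡 n) ∞ M]
  [IsContMDiffRiemannianBundle (𝓡 n) ∞ (EuclideanSpace ℝ (Fin n))
    (fun p : M => TangentSpace (𝓡 n) p)]

/-- The edges of a straight simplex have length at most a multiple of the mesh in the chart. -/
theorem IsStraight.norm_vertexCoord_sub_le (h : K.IsStraight x σ)
    (hx : x ∈ IsManifold.maximalAtlas (𝓡 n) ∞ M) (hσ : K.cell σ ⊆ x.source) {C : ℝ} (hC0 : 0 ≤ C)
    (hC : ∀ p ∈ K.cell σ, ∀ q ∈ K.cell σ, Manifold.riemannianEDist (𝓡 n) p q ≠ ⊤ →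
      ‖x p - x q‖ ≤ C * (Manifold.riemannianEDist (𝓡 n) p q).toReal)
    {v w : V} (hv : v ∈ σ.1) (hw : w ∈ σ.1) :
    ‖K.vertexCoord x v - K.vertexCoord x w‖ ≤ C * K.mesh := by
  rcases eq_or_ne v w with rfl | hvw
  · rw [sub_self, norm_zero]
    exact mul_nonneg hC0 mesh_nonneg
  have hvc := vertex_mem_cell (K := K) hv
  have hwc := vertex_mem_cell (K := K) hw
  -- The edge has finite length, so that the Lipschitz bound applies to its endpoints.
  have hseg : segment ℝ (x (K.vertex v)) (x (K.vertex w)) ⊆ x.target :=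
    (h.segment_subset hvc hwc).trans (by
      rintro _ ⟨p, hp, rfl⟩
      exact x.map_source (hσ hp))
  have hfin := riemannianEDist_ne_top_of_segment_subset hx hseg
  rw [x.left_inv (hσ hvc), x.left_inv (hσ hwc)] at hfin
  exact (hC _ hvc _ hwc hfin).trans
    (mul_le_mul_of_nonneg_left (toReal_riemannianEDist_le_mesh hv hw hvw) hC0)

/-- The differentials of the barycentric coordinates of a straight simplex are at most of the order
of the inverse of the mesh. By Cramer's rule they are quotients of determinants, and the fullness
bounds the denominator from below. -/
theorem IsStraight.exists_abs_mfderivWithin_bary_le (h : K.IsStraight x σ)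
    (hx : x ∈ IsManifold.maximalAtlas (𝓡 n) ∞ M) (hσ : K.cell σ ⊆ x.source)
    {Θ₀ : ℝ} (hΘ₀ : 0 < Θ₀) (hK : Θ₀ ≤ K.fullness) {C Λ : ℝ} (hC0 : 0 ≤ C) (hΛ1 : 1 ≤ Λ)
    (hC : ∀ v ∈ σ.1, ∀ w ∈ σ.1, ‖K.vertexCoord x v - K.vertexCoord x w‖ ≤ C * K.mesh)
    (hΛ : ∀ p ∈ K.cell σ, ∀ v : TangentSpace (𝓡 n) p,
      ‖chartDeriv x p v‖ ≤ Λ * ‖v‖ ∧ ‖v‖ ≤ Λ * ‖chartDeriv x p v‖) :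
    (columnMatrix (σ.edge (K.vertexCoord x))).det ≠ 0 ∧ ∃ δ : ℝ, 0 ≤ δ ∧
      K.mesh * δ ≤ n * (√(n.factorial * (Λ ^ 2) ^ n) / Θ₀ * (n.factorial * C ^ (n - 1)) * Λ) ∧
      ∀ p ∈ K.cell σ, ∀ (v : V) (w : TangentSpace (𝓡 n) p),
        |((σ.inclDeriv v ∘ₗ coordsOf (σ.edge (K.vertexCoord x))) ∘ₗ
          (chartDeriv x p).toLinearMap) w| ≤ δ * ‖w‖ := by
  set e := σ.edge (K.vertexCoord x) with he
  set κ := √(n.factorial * (Λ ^ 2) ^ n) with hκ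
  have hη := mesh_nonneg (K := K)
  have hηn := mesh_pow_pos hΘ₀ hK σ
  have hκ0 : 0 < κ := by
    have : 0 < Λ := by linarith
    positivity
  have hdetle : Θ₀ * K.mesh ^ n ≤ κ * |(columnMatrix e).det| :=
    (mul_mesh_pow_le_vol hΘ₀ hK σ).trans (h.vol_le hx hσ fun p hp v => (hΛ p hp v).2)
  have hdpos : 0 < |(columnMatrix e).det| := by
    have : 0 < κ * |(columnMatrix e).det| := (mul_pos hΘ₀ hηn).trans_le hdetle
    exact pos_of_mul_pos_right this hκ0.le
  have hdet : (columnMatrix e).det ≠ 0 := abs_pos.1 hdpos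
  have hei : ∀ i, ‖e i‖ ≤ C * K.mesh := fun i => hC _ (σ.vert_mem _) _ (σ.vert_mem _)
  refine ⟨hdet, n * (|(columnMatrix e).det|⁻¹ * (n.factorial * (C * K.mesh) ^ (n - 1)) * Λ),
    by positivity, ?_, fun p hp v w => ?_⟩
  · have hinv : |(columnMatrix e).det|⁻¹ ≤ κ / Θ₀ * (K.mesh ^ n)⁻¹ := by
      rw [inv_le_iff_one_le_mul₀ hdpos]
      have h1 : κ / Θ₀ * (K.mesh ^ n)⁻¹ * |(columnMatrix e).det| =
          (κ * |(columnMatrix e).det|) / (Θ₀ * K.mesh ^ n) := by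
        field_simp
      rw [h1, one_le_div (by positivity)]
      exact hdetle
    -- For `n = 0` the subtraction `n - 1` is truncated, but the factor `n` vanishes.
    rcases Nat.eq_zero_or_pos n with hn | hn
    · subst hn
      simp
    · have hmesh : K.mesh * K.mesh ^ (n - 1) = K.mesh ^ n := by
        rw [← pow_succ', Nat.sub_add_cancel hn]
      calc K.mesh * (n * (|(columnMatrix e).det|⁻¹ * (n.factorial * (C * K.mesh) ^ (n - 1)) * Λ))
          = n * (|(columnMatrix e).det|⁻¹ * (K.mesh * K.mesh ^ (n - 1)) *
              (n.factorial * C ^ (n - 1)) * Λ) := by rw [mul_pow]; ring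
        _ ≤ n * (κ / Θ₀ * (K.mesh ^ n)⁻¹ * (K.mesh * K.mesh ^ (n - 1)) *
              (n.factorial * C ^ (n - 1)) * Λ) := by gcongr
        _ = n * (κ / Θ₀ * (n.factorial * C ^ (n - 1)) * Λ) := by
            rw [hmesh, mul_assoc (κ / Θ₀), inv_mul_cancel₀ hηn.ne', mul_one]
  · have h1 : ‖coordsOf e (chartDeriv x p w)‖ ≤
        |(columnMatrix e).det|⁻¹ * (n.factorial * (C * K.mesh) ^ (n - 1)) * (Λ * ‖w‖) := by
      refine (pi_norm_le_iff_of_nonneg (by positivity)).2 fun i => ?_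
      refine (abs_coordsOf_le hei _ i).trans ?_
      gcongr
      exact (hΛ p hp w).1
    refine (σ.abs_inclDeriv_le v _).trans ?_
    calc (n : ℝ) * ‖coordsOf e (chartDeriv x p w)‖
        ≤ n * (|(columnMatrix e).det|⁻¹ * (n.factorial * (C * K.mesh) ^ (n - 1)) *
          (Λ * ‖w‖)) := by gcongr
      _ = _ := by ring

end Metric

end SmoothTriangulation

end Geometry

/-! ### Smooth forms on a straight simplex -/

section Estimates

open Set Filter Topology MeasureTheory

variable {V : Type*} [Fintype V] [LinearOrder V]
variable {n : ℕ} {M : Type*} [TopologicalSpace M] [ChartedSpace (EuclideanSpace ℝ (Fin n)) M]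
  {x : OpenPartialHomeomorph M (EuclideanSpace ℝ (Fin n))}

/-- The form `α` in the chart `x`, as an element of the exterior algebra at each point. -/
noncomputable def DiffForm.inChart (α : DiffForm n M) (x : OpenPartialHomeomorph M (EuclideanSpace ℝ (Fin n)))
    (y : EuclideanSpace ℝ (Fin n)) : Exterior (EuclideanSpace ℝ (Fin n)) :=
  fun j => (coordRep x (α.toFun j) y).toAlternatingMap

theorem DiffForm.at_eq_inChart_comp (hx : x ∈ IsManifold.maximalAtlas (𝓡 n) ∞ M)
    (α : DiffForm n M) {p : M} (hp : p ∈ x.source) :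
    α.at_ p = (α.inChart x (x p)).comp (chartDeriv x p).toLinearMap := by
  ext j v
  exact apply_eq_coordRep hx (α.toFun j) hp v

theorem DiffForm.partialDeriv_eq_comp (α : DiffForm n M) (i : Fin n) (p : M) :
    α.partialDeriv x i p =
      Exterior.comp (fun j => (fderiv ℝ (coordRep x (α.toFun j)) (x p)
        (EuclideanSpace.single i (1 : ℝ))).toAlternatingMap) (chartDeriv x p).toLinearMap :=
  rfl

theorem finrank_tangentSpace (p : M) : Module.finrank ℝ (TangentSpace (𝓡 n) p) = n :=
  (finrank_euclideanSpace (𝕜 := ℝ) (ι := Fin n)).trans (Fintype.card_fin n)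

section Pullback

theorem prod_norm_map_le {T F : Type*} [SeminormedAddCommGroup T] [SeminormedAddCommGroup F]
    (f : T → F) {Λ : ℝ} (hΛ1 : 1 ≤ Λ) (hf : ∀ v, ‖f v‖ ≤ Λ * ‖v‖) {j : ℕ} (hj : j ≤ n)
    (v : Fin j → T) : ∏ i, ‖f (v i)‖ ≤ Λ ^ n * ∏ i, ‖v i‖ := by
  calc ∏ i, ‖f (v i)‖ ≤ ∏ i, Λ * ‖v i‖ :=
        Finset.prod_le_prod (fun _ _ => norm_nonneg _) fun i _ => hf _
    _ = Λ ^ j * ∏ i, ‖v i‖ := by simp [Finset.prod_mul_distrib]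
    _ ≤ Λ ^ n * ∏ i, ‖v i‖ := mul_le_mul_of_nonneg_right (pow_le_pow_right₀ hΛ1 hj)
        (Finset.prod_nonneg fun _ _ => norm_nonneg _)

variable {T F : Type*} [NormedAddCommGroup T] [InnerProductSpace ℝ T] [FiniteDimensional ℝ T]
  [NormedAddCommGroup F] [NormedSpace ℝ F]

/-- The norm of the pullback of a bounded form. -/
theorem Exterior.norm_comp_le (hn : Module.finrank ℝ T = n) (f : T →ₗ[ℝ] F) {Λ : ℝ} (hΛ1 : 1 ≤ Λ)
    (hf : ∀ v, ‖f v‖ ≤ Λ * ‖v‖) (γ : Exterior F) {B : ℝ} (hB : 0 ≤ B)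
    (h : ∀ j ≤ n, ∀ u, |γ j u| ≤ B * ∏ i, ‖u i‖) :
    (γ.comp f).norm ≤ √(∑ j ∈ Finset.range (n + 1), (n : ℝ) ^ j) * (B * Λ ^ n) := by
  refine Exterior.norm_le_of_abs_le hn _ (by positivity) fun j v => ?_
  by_cases hj : n < j
  · rw [alternating_eq_zero_of_finrank_lt (hn ▸ hj), abs_zero]
    positivity
  · refine (h j (by omega) _).trans ?_
    rw [mul_assoc]
    exact mul_le_mul_of_nonneg_left (prod_norm_map_le f hΛ1 hf (by omega) v) hB

/-- A form is bounded by its pullback under an isomorphism `f` with inverse `g`. -/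
theorem Exterior.abs_apply_le_norm_comp (hn : Module.finrank ℝ T = n) (f : T →ₗ[ℝ] F)
    (g : F →ₗ[ℝ] T) (hfg : ∀ u, f (g u) = u) {Λ : ℝ} (hΛ1 : 1 ≤ Λ)
    (hg : ∀ u, ‖g u‖ ≤ Λ * ‖u‖) (γ : Exterior F) (j : ℕ) (u : Fin j → F) :
    |γ j u| ≤ (n + 1) ^ n * Λ ^ n * (γ.comp f).norm * ∏ i, ‖u i‖ := by
  have hN := (γ.comp f).norm_nonneg
  have h2 : (γ.comp f) j (fun i => g (u i)) = γ j u := by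
    change γ j (fun i => f (g (u i))) = _
    simp only [hfg]
  rw [← h2]
  by_cases hj : n < j
  · rw [alternating_eq_zero_of_finrank_lt (hn ▸ hj), abs_zero]
    positivity
  refine ((γ.comp f).abs_apply_le hn j _).trans ?_
  calc _ ≤ (n + 1 : ℝ) ^ n * (γ.comp f).norm * (Λ ^ n * ∏ i, ‖u i‖) :=
        mul_le_mul_of_nonneg_left (prod_norm_map_le g hΛ1 hg (by omega) u) (by positivity)
    _ = _ := by ring

end Pullback

theorem SmoothTriangulation.prod_norm_edge_le {K : SmoothTriangulation n M V}
    {σ : Simplex K.complex n} {d : ℝ}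
    (hd : ∀ v ∈ σ.1, ∀ w ∈ σ.1, ‖K.vertexCoord x v - K.vertexCoord x w‖ ≤ d) {j : ℕ}
    {τ : Simplex K.complex j} (hτ : τ.1 ⊆ σ.1) :
    ∏ i, ‖τ.edge (K.vertexCoord x) i‖ ≤ d ^ j := by
  calc _ ≤ ∏ _i : Fin j, d := Finset.prod_le_prod (fun _ _ => norm_nonneg _)
        fun i _ => hd _ (hτ (τ.vert_mem _)) _ (hτ (τ.vert_mem _))
    _ = d ^ j := by simp

variable [Bundle.RiemannianBundle (fun p : M => TangentSpace (𝓡 n) p)]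

theorem Exterior.norm_comp_chartDeriv_le {p : M} {Λ : ℝ} (hΛ1 : 1 ≤ Λ)
    (hΛ : ∀ v : TangentSpace (𝓡 n) p, ‖chartDeriv x p v‖ ≤ Λ * ‖v‖)
    (γ : Exterior (EuclideanSpace ℝ (Fin n))) {B : ℝ} (hB : 0 ≤ B)
    (h : ∀ j ≤ n, ∀ u, |γ j u| ≤ B * ∏ i, ‖u i‖) :
    (γ.comp (chartDeriv x p).toLinearMap).norm ≤
      √(∑ j ∈ Finset.range (n + 1), (n : ℝ) ^ j) * (B * Λ ^ n) :=
  Exterior.norm_comp_le (T := TangentSpace (𝓡 n) p) (finrank_tangentSpace p)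
    (chartDeriv x p).toLinearMap hΛ1 hΛ γ hB h

theorem Exterior.abs_apply_le_norm_comp_chartDeriv (hx : x ∈ IsManifold.maximalAtlas (𝓡 n) ∞ M)
    {p : M} (hp : p ∈ x.source) {Λ : ℝ} (hΛ1 : 1 ≤ Λ)
    (hΛ : ∀ v : TangentSpace (𝓡 n) p, ‖v‖ ≤ Λ * ‖chartDeriv x p v‖)
    (γ : Exterior (EuclideanSpace ℝ (Fin n))) (j : ℕ) (u : Fin j → EuclideanSpace ℝ (Fin n)) :
    |γ j u| ≤
      (n + 1) ^ n * Λ ^ n * (γ.comp (chartDeriv x p).toLinearMap).norm * ∏ i, ‖u i‖ := by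
  obtain ⟨y, hy, rfl⟩ : ∃ y ∈ x.target, x.symm y = p := ⟨x p, x.map_source hp, x.left_inv hp⟩
  have hg : ∀ u, ‖chartSymmDeriv x y u‖ ≤ Λ * ‖u‖ := fun u => by
    have := hΛ (chartSymmDeriv x y u)
    rwa [chartDeriv_chartSymmDeriv hx hy] at this
  exact Exterior.abs_apply_le_norm_comp (T := TangentSpace (𝓡 n) (x.symm y))
    (finrank_tangentSpace (x.symm y)) (chartDeriv x (x.symm y)).toLinearMap
    (chartSymmDeriv x y).toLinearMap (chartDeriv_chartSymmDeriv hx hy) hΛ1 hg γ j u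

section Sup

variable {S : Set M} {Λ : ℝ}

/-- The supremum defining `supNorm` is finite on a compact set. -/
theorem DiffForm.bddAbove_norm (hx : x ∈ IsManifold.maximalAtlas (𝓡 n) ∞ M) (hS : IsCompact S)
    (hSx : S ⊆ x.source) (hΛ1 : 1 ≤ Λ)
    (hΛ : ∀ p ∈ S, ∀ v : TangentSpace (𝓡 n) p, ‖chartDeriv x p v‖ ≤ Λ * ‖v‖) (α : DiffForm n M) :
    BddAbove (Set.range fun p : S => (α.at_ p.1).norm) := by
  have hcomp : IsCompact (x '' S) := hS.image_of_continuousOn (x.continuousOn.mono hSx)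
  have hsub : x '' S ⊆ x.target := by
    rintro _ ⟨p, hp, rfl⟩
    exact x.map_source (hSx hp)
  choose B hB using fun j => hcomp.exists_bound_of_continuousOn
    ((α.smooth j x hx).continuousOn.mono hsub)
  refine ⟨√(∑ j ∈ Finset.range (n + 1), (n : ℝ) ^ j) *
    ((∑ j ∈ Finset.range (n + 1), |B j|) * Λ ^ n), ?_⟩
  rintro _ ⟨⟨p, hp⟩, rfl⟩
  simp only
  rw [α.at_eq_inChart_comp hx (hSx hp)]
  refine Exterior.norm_comp_chartDeriv_le (B := ∑ j ∈ Finset.range (n + 1), |B j|) hΛ1 (hΛ p hp) _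
    (Finset.sum_nonneg fun _ _ => abs_nonneg _) fun j hj u => ?_
  refine ((coordRep x (α.toFun j) (x p)).le_opNorm u).trans ?_
  gcongr
  calc ‖coordRep x (α.toFun j) (x p)‖ ≤ |B j| := (hB j _ ⟨p, hp, rfl⟩).trans (le_abs_self _)
    _ ≤ _ := Finset.single_le_sum (f := fun j => |B j|) (fun _ _ => abs_nonneg _)
        (Finset.mem_range.2 (by omega))

theorem DiffForm.bddAbove_norm_partialDeriv (hx : x ∈ IsManifold.maximalAtlas (𝓡 n) ∞ M)
    (hS : IsCompact S) (hSx : S ⊆ x.source) (hΛ1 : 1 ≤ Λ)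
    (hΛ : ∀ p ∈ S, ∀ v : TangentSpace (𝓡 n) p, ‖chartDeriv x p v‖ ≤ Λ * ‖v‖) (α : DiffForm n M) :
    BddAbove (Set.range fun q : S × Fin n => (α.partialDeriv x q.2 q.1.1).norm) := by
  have hcomp : IsCompact (x '' S) := hS.image_of_continuousOn (x.continuousOn.mono hSx)
  have hsub : x '' S ⊆ x.target := by
    rintro _ ⟨p, hp, rfl⟩
    exact x.map_source (hSx hp)
  choose B hB using fun j => hcomp.exists_bound_of_continuousOn
    (((α.smooth j x hx).continuousOn_fderiv_of_isOpen x.open_target (by simp)).mono hsub)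
  refine ⟨√(∑ j ∈ Finset.range (n + 1), (n : ℝ) ^ j) *
    ((∑ j ∈ Finset.range (n + 1), |B j|) * Λ ^ n), ?_⟩
  rintro _ ⟨⟨⟨p, hp⟩, i⟩, rfl⟩
  simp only
  rw [α.partialDeriv_eq_comp]
  refine Exterior.norm_comp_chartDeriv_le (B := ∑ j ∈ Finset.range (n + 1), |B j|) hΛ1 (hΛ p hp) _
    (Finset.sum_nonneg fun _ _ => abs_nonneg _) fun j hj u => ?_
  refine ((fderiv ℝ (coordRep x (α.toFun j)) (x p)
    (EuclideanSpace.single i (1 : ℝ))).le_opNorm u).trans ?_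
  gcongr
  calc _ ≤ ‖fderiv ℝ (coordRep x (α.toFun j)) (x p)‖ * ‖EuclideanSpace.single i (1 : ℝ)‖ :=
        ContinuousLinearMap.le_opNorm _ _
    _ = ‖fderiv ℝ (coordRep x (α.toFun j)) (x p)‖ := by simp
    _ ≤ |B j| := (hB j _ ⟨p, hp, rfl⟩).trans (le_abs_self _)
    _ ≤ _ := Finset.single_le_sum (f := fun j => |B j|) (fun _ _ => abs_nonneg _)
        (Finset.mem_range.2 (by omega))

theorem DiffForm.supNorm_nonneg (α : DiffForm n M) (S : Set M) : 0 ≤ α.supNorm S :=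
  Real.iSup_nonneg fun _ => Exterior.norm_nonneg _

theorem DiffForm.supPartialDeriv_nonneg (α : DiffForm n M)
    (x : OpenPartialHomeomorph M (EuclideanSpace ℝ (Fin n))) (S : Set M) :
    0 ≤ α.supPartialDeriv x S :=
  Real.iSup_nonneg fun _ => Exterior.norm_nonneg _

/-- The components of a form in the chart are bounded by its Riemannian supremum norm. -/
theorem DiffForm.norm_coordRep_le (hx : x ∈ IsManifold.maximalAtlas (𝓡 n) ∞ M) (hS : IsCompact S)
    (hSx : S ⊆ x.source) (hΛ1 : 1 ≤ Λ) (hΛ : ∀ p ∈ S, ∀ v : TangentSpace (𝓡 n) p,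
      ‖chartDeriv x p v‖ ≤ Λ * ‖v‖ ∧ ‖v‖ ≤ Λ * ‖chartDeriv x p v‖)
    (α : DiffForm n M) {p : M} (hp : p ∈ S) (j : ℕ) :
    ‖coordRep x (α.toFun j) (x p)‖ ≤ (n + 1) ^ n * Λ ^ n * α.supNorm S := by
  have h0 := α.supNorm_nonneg S
  refine ContinuousAlternatingMap.opNorm_le_bound _ (by positivity) fun u => ?_
  have h1 := Exterior.abs_apply_le_norm_comp_chartDeriv hx (hSx hp) hΛ1 (fun v => (hΛ p hp v).2)
    (α.inChart x (x p)) j u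
  rw [← α.at_eq_inChart_comp hx (hSx hp)] at h1
  refine h1.trans ?_
  gcongr
  exact le_ciSup (f := fun p : S => (α.at_ p.1).norm)
    (α.bddAbove_norm hx hS hSx hΛ1 fun p hp v => (hΛ p hp v).1) ⟨p, hp⟩

/-- The derivative of the components of a form in the chart is bounded by the Riemannian norms of its
partial derivatives. -/
theorem DiffForm.norm_fderiv_coordRep_le (hx : x ∈ IsManifold.maximalAtlas (𝓡 n) ∞ M)
    (hS : IsCompact S) (hSx : S ⊆ x.source) (hΛ1 : 1 ≤ Λ)
    (hΛ : ∀ p ∈ S, ∀ v : TangentSpace (𝓡 n) p,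
      ‖chartDeriv x p v‖ ≤ Λ * ‖v‖ ∧ ‖v‖ ≤ Λ * ‖chartDeriv x p v‖)
    (α : DiffForm n M) {p : M} (hp : p ∈ S) (j : ℕ) :
    ‖fderiv ℝ (coordRep x (α.toFun j)) (x p)‖ ≤
      n * ((n + 1) ^ n * Λ ^ n * α.supPartialDeriv x S) := by
  have h0 := α.supPartialDeriv_nonneg x S
  have h1 : ∀ i : Fin n, ‖fderiv ℝ (coordRep x (α.toFun j)) (x p)
      (EuclideanSpace.single i (1 : ℝ))‖ ≤ (n + 1) ^ n * Λ ^ n * α.supPartialDeriv x S := by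
    intro i
    refine ContinuousAlternatingMap.opNorm_le_bound _ (by positivity) fun u => ?_
    have h1 := Exterior.abs_apply_le_norm_comp_chartDeriv hx (hSx hp) hΛ1
      (fun v => (hΛ p hp v).2) (fun j => (fderiv ℝ (coordRep x (α.toFun j)) (x p)
        (EuclideanSpace.single i (1 : ℝ))).toAlternatingMap) j u
    rw [← α.partialDeriv_eq_comp] at h1
    refine h1.trans ?_
    gcongr
    exact le_ciSup (f := fun q : S × Fin n => (α.partialDeriv x q.2 q.1.1).norm)
      (α.bddAbove_norm_partialDeriv hx hS hSx hΛ1 fun p hp v => (hΛ p hp v).1) (⟨p, hp⟩, i)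
  refine ContinuousLinearMap.opNorm_le_bound _ (by positivity) fun w => ?_
  have hw : w = ∑ i, w i • EuclideanSpace.single i (1 : ℝ) := by
    conv_lhs => rw [← (EuclideanSpace.basisFun (Fin n) ℝ).sum_repr w]
    simp
  conv_lhs => rw [hw, map_sum]
  refine (norm_sum_le _ _).trans ?_
  calc _ ≤ ∑ i : Fin n, ‖w‖ * ((n + 1) ^ n * Λ ^ n * α.supPartialDeriv x S) := by
        refine Finset.sum_le_sum fun i _ => ?_
        rw [map_smul, norm_smul]
        exact mul_le_mul (PiLp.norm_apply_le w i) (h1 i) (norm_nonneg _) (norm_nonneg _)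
    _ = _ := by
        rw [Finset.sum_const, Finset.card_univ, Fintype.card_fin, nsmul_eq_mul]
        ring

end Sup

namespace SmoothTriangulation

variable {K : SmoothTriangulation n M V} {σ : Simplex K.complex n} {Λ d : ℝ}

/-- In the chart a form varies on a straight simplex by at most its derivative times the
diameter. -/
theorem IsStraight.norm_coordRep_sub_le (h : K.IsStraight x σ)
    (hx : x ∈ IsManifold.maximalAtlas (𝓡 n) ∞ M) (hσ : K.cell σ ⊆ x.source) (hΛ1 : 1 ≤ Λ)
    (hΛ : ∀ p ∈ K.cell σ, ∀ v : TangentSpace (𝓡 n) p,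
      ‖chartDeriv x p v‖ ≤ Λ * ‖v‖ ∧ ‖v‖ ≤ Λ * ‖chartDeriv x p v‖)
    (hd : ∀ v ∈ σ.1, ∀ w ∈ σ.1, ‖K.vertexCoord x v - K.vertexCoord x w‖ ≤ d)
    (α : DiffForm n M) {p q : M} (hp : p ∈ K.cell σ) (hq : q ∈ K.cell σ) (j : ℕ) :
    ‖coordRep x (α.toFun j) (x q) - coordRep x (α.toFun j) (x p)‖ ≤
      n * ((n + 1) ^ n * Λ ^ n * α.supPartialDeriv x (K.cell σ)) * d := by
  have h0 := α.supPartialDeriv_nonneg x (K.cell σ)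
  refine (h.convex_image.norm_image_sub_le_of_norm_fderiv_le (𝕜 := ℝ) (fun y hy => ?_)
    (fun y hy => ?_) ⟨p, hp, rfl⟩ ⟨q, hq, rfl⟩).trans
    (mul_le_mul_of_nonneg_left (h.norm_sub_le hd hq hp) (by positivity))
  · obtain ⟨r, hr, rfl⟩ := hy
    exact ((α.smooth j x hx).contDiffAt
      (x.open_target.mem_nhds (x.map_source (hσ hr)))).differentiableAt (by simp)
  · obtain ⟨r, hr, rfl⟩ := hy
    exact α.norm_fderiv_coordRep_le hx cell_isCompact hσ hΛ1 hΛ hr j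

/-- The integral of a form over a `j`-face of a straight simplex of size `d` is of order `dʲ`. -/
theorem IsStraight.abs_deRham_le (h : K.IsStraight x σ)
    (hx : x ∈ IsManifold.maximalAtlas (𝓡 n) ∞ M) (hσ : K.cell σ ⊆ x.source) (hΛ1 : 1 ≤ Λ)
    (hΛ : ∀ p ∈ K.cell σ, ∀ v : TangentSpace (𝓡 n) p,
      ‖chartDeriv x p v‖ ≤ Λ * ‖v‖ ∧ ‖v‖ ≤ Λ * ‖chartDeriv x p v‖) (hd0 : 0 ≤ d)
    (hd : ∀ v ∈ σ.1, ∀ w ∈ σ.1, ‖K.vertexCoord x v - K.vertexCoord x w‖ ≤ d)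
    (α : DiffForm n M) {j : ℕ} {τ : Simplex K.complex j} (hτ : τ.1 ⊆ σ.1) :
    |K.deRham α j τ| ≤ (n + 1) ^ n * Λ ^ n * α.supNorm (K.cell σ) * d ^ j := by
  have h0 := α.supNorm_nonneg (K.cell σ)
  rw [h.deRham_eq hx hσ α hτ, ← Real.norm_eq_abs]
  refine (norm_setIntegral_le_of_norm_le_const
    (C := (n + 1) ^ n * Λ ^ n * α.supNorm (K.cell σ) * d ^ j)
    (volume_corner_lt_top j) fun t ht => ?_).trans ?_
  · refine (ContinuousAlternatingMap.le_opNorm _ _).trans ?_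
    exact mul_le_mul (α.norm_coordRep_le hx cell_isCompact hσ hΛ1 hΛ (param_mem_cell hτ ht) j)
      (prod_norm_edge_le hd hτ) (Finset.prod_nonneg fun _ _ => norm_nonneg _) (by positivity)
  · rw [volume_real_corner]
    exact mul_le_of_le_one_right (by positivity)
      (inv_le_one_of_one_le₀ (by exact_mod_cast Nat.succ_le_of_lt j.factorial_pos))

theorem abs_constCochain_le
    (hx : x ∈ IsManifold.maximalAtlas (𝓡 n) ∞ M) (hσ : K.cell σ ⊆ x.source) (hΛ1 : 1 ≤ Λ)
    (hΛ : ∀ p ∈ K.cell σ, ∀ v : TangentSpace (𝓡 n) p,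
      ‖chartDeriv x p v‖ ≤ Λ * ‖v‖ ∧ ‖v‖ ≤ Λ * ‖chartDeriv x p v‖)
    (hd : ∀ v ∈ σ.1, ∀ w ∈ σ.1, ‖K.vertexCoord x v - K.vertexCoord x w‖ ≤ d)
    (α : DiffForm n M) {p : M} (hp : p ∈ K.cell σ) {j : ℕ} {τ : Simplex K.complex j}
    (hτ : τ.1 ⊆ σ.1) :
    |constCochain (K.vertexCoord x) (α.inChart x (x p)) j τ| ≤
      (n + 1) ^ n * Λ ^ n * α.supNorm (K.cell σ) * d ^ j := by
  have h0 := α.supNorm_nonneg (K.cell σ)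
  rw [constCochain, abs_mul, abs_of_nonneg (by positivity : (0 : ℝ) ≤ (j.factorial : ℝ)⁻¹)]
  refine (mul_le_of_le_one_left (abs_nonneg _) (inv_le_one_of_one_le₀
    (by exact_mod_cast Nat.succ_le_of_lt j.factorial_pos))).trans ?_
  refine ((coordRep x (α.toFun j) (x p)).le_opNorm _).trans ?_
  exact mul_le_mul (α.norm_coordRep_le hx cell_isCompact hσ hΛ1 hΛ hp j)
    (prod_norm_edge_le hd hτ) (Finset.prod_nonneg fun _ _ => norm_nonneg _) (by positivity)

/-- Freezing the coefficients of a form at a point of the simplex changes its integral over a `j`-face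
by a quantity of order `dʲ⁺¹`. -/
theorem IsStraight.abs_deRham_sub_constCochain_le (h : K.IsStraight x σ)
    (hx : x ∈ IsManifold.maximalAtlas (𝓡 n) ∞ M) (hσ : K.cell σ ⊆ x.source) (hΛ1 : 1 ≤ Λ)
    (hΛ : ∀ p ∈ K.cell σ, ∀ v : TangentSpace (𝓡 n) p,
      ‖chartDeriv x p v‖ ≤ Λ * ‖v‖ ∧ ‖v‖ ≤ Λ * ‖chartDeriv x p v‖) (hd0 : 0 ≤ d)
    (hd : ∀ v ∈ σ.1, ∀ w ∈ σ.1, ‖K.vertexCoord x v - K.vertexCoord x w‖ ≤ d)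
    (α : DiffForm n M) {p : M} (hp : p ∈ K.cell σ) {j : ℕ} {τ : Simplex K.complex j}
    (hτ : τ.1 ⊆ σ.1) :
    |K.deRham α j τ - constCochain (K.vertexCoord x) (α.inChart x (x p)) j τ| ≤
      n * ((n + 1) ^ n * Λ ^ n * α.supPartialDeriv x (K.cell σ)) * d * d ^ j := by
  have h0 := α.supPartialDeriv_nonneg x (K.cell σ)
  have hconst : constCochain (K.vertexCoord x) (α.inChart x (x p)) j τ =
      ∫ _t in corner j, coordRep x (α.toFun j) (x p) (τ.edge (K.vertexCoord x)) := by
    rw [setIntegral_const, volume_real_corner]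
    rfl
  have hcont : ContinuousOn (fun t => x (K.param τ t)) (corner j) := by
    have h1 : Continuous fun t : Fin j → ℝ =>
      K.vertexCoord x (τ.vert 0) + ∑ i, t i • τ.edge (K.vertexCoord x) i := by fun_prop
    exact h1.continuousOn.congr fun t ht => h.chart_param hτ ht
  have hcont2 : ContinuousOn (fun t => coordRep x (α.toFun j) (x (K.param τ t))
      (τ.edge (K.vertexCoord x))) (corner j) := by
    have h1 : ContinuousOn (fun t => coordRep x (α.toFun j) (x (K.param τ t))) (corner j) :=
      (α.smooth j x hx).continuousOn.comp hcont
        fun t ht => x.map_source (hσ (param_mem_cell hτ ht))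
    exact (ContinuousAlternatingMap.apply ℝ _ ℝ
      (τ.edge (K.vertexCoord x))).continuous.comp_continuousOn h1
  rw [h.deRham_eq hx hσ α hτ, hconst, ← integral_sub
    (hcont2.integrableOn_compact (isCompact_corner j))
    (continuousOn_const.integrableOn_compact (isCompact_corner j)), ← Real.norm_eq_abs]
  refine (norm_setIntegral_le_of_norm_le_const
    (C := n * ((n + 1) ^ n * Λ ^ n * α.supPartialDeriv x (K.cell σ)) * d * d ^ j)
    (volume_corner_lt_top j) fun t ht => ?_).trans ?_
  · rw [← ContinuousAlternatingMap.sub_apply]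
    refine (ContinuousAlternatingMap.le_opNorm _ _).trans ?_
    exact mul_le_mul (h.norm_coordRep_sub_le hx hσ hΛ1 hΛ hd α hp (param_mem_cell hτ ht) j)
      (prod_norm_edge_le hd hτ) (Finset.prod_nonneg fun _ _ => norm_nonneg _) (by positivity)
  · rw [volume_real_corner]
    exact mul_le_of_le_one_right (by positivity)
      (inv_le_one_of_one_le₀ (by exact_mod_cast Nat.succ_le_of_lt j.factorial_pos))

end SmoothTriangulation

end Estimates

/-! ### The estimate for the product -/

section Product

variable {V : Type*} [Fintype V] [LinearOrder V]
variable {n : ℕ} {M : Type*} [TopologicalSpace M] [ChartedSpace (EuclideanSpace ℝ (Fin n)) M]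
  {K : SmoothTriangulation n M V} {x : OpenPartialHomeomorph M (EuclideanSpace ℝ (Fin n))}
  {σ : Simplex K.complex n}

/-- The barycentric coordinates of a nondegenerate affine simplex recover the identity:
`∑ᵥ dμᵥ ⊗ Pᵥ = id`. -/
theorem sum_inclDeriv_coordsOf_smulRight (P : V → EuclideanSpace ℝ (Fin n))
    (hdet : (columnMatrix (σ.edge P)).det ≠ 0) {T : Type*} [AddCommGroup T] [Module ℝ T]
    (L : T →ₗ[ℝ] EuclideanSpace ℝ (Fin n)) :
    ∑ v, ((σ.inclDeriv v ∘ₗ coordsOf (σ.edge P)) ∘ₗ L).smulRight (P v) = L := by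
  ext1 w
  have h := σ.sum_inclDeriv_smulRight P (coordsOf (σ.edge P) (L w))
  rw [sum_coordsOf_smul hdet] at h
  rw [← h]
  simp only [LinearMap.sum_apply, LinearMap.smulRight_apply, LinearMap.comp_apply]

/-- The constant in the estimate on a straight simplex: `C` and `Λ` bound the distortion of lengths
by the chart, `Θ₀` bounds the fullness from below. -/
noncomputable def productConst (n : ℕ) (Θ₀ C Λ : ℝ) : ℝ :=
  √(∑ j ∈ Finset.range (n + 1), (n : ℝ) ^ j) * (whitneyConst n * (cupConst n *
    (n * ((n + 1) ^ n * Λ ^ n) ^ 2 * C) *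
      max 1 (C * (n * (√(n.factorial * (Λ ^ 2) ^ n) / Θ₀ * (n.factorial * C ^ (n - 1)) * Λ))) ^ n))

namespace SmoothTriangulation

variable [Bundle.RiemannianBundle (fun p : M => TangentSpace (𝓡 n) p)]

variable [IsManifold (𝓡 n) ∞ M]
  [IsContMDiffRiemannianBundle (𝓡 n) ∞ (EuclideanSpace ℝ (Fin n))
    (fun p : M => TangentSpace (𝓡 n) p)]

/-- The estimate on a straight simplex, obtained by comparing the two forms with their values at `p`,
considered as forms with constant coefficients in the chart. -/
theorem IsStraight.norm_whitney_cup_sub_le (h : K.IsStraight x σ)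
    (hx : x ∈ IsManifold.maximalAtlas (𝓡 n) ∞ M) (hσ : K.cell σ ⊆ x.source)
    {Θ₀ : ℝ} (hΘ₀ : 0 < Θ₀) (hK : Θ₀ ≤ K.fullness) {C Λ : ℝ} (hC0 : 0 ≤ C) (hΛ1 : 1 ≤ Λ)
    (hC : ∀ p ∈ K.cell σ, ∀ q ∈ K.cell σ, Manifold.riemannianEDist (𝓡 n) p q ≠ ⊤ →
      ‖x p - x q‖ ≤ C * (Manifold.riemannianEDist (𝓡 n) p q).toReal)
    (hΛ : ∀ p ∈ K.cell σ, ∀ v : TangentSpace (𝓡 n) p,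
      ‖chartDeriv x p v‖ ≤ Λ * ‖v‖ ∧ ‖v‖ ≤ Λ * ‖chartDeriv x p v‖)
    (ω₁ ω₂ : DiffForm n M) {p : M} (hp : p ∈ K.cell σ) :
    (K.whitney (cup (K.deRham ω₁) (K.deRham ω₂)) σ p - (ω₁.at_ p).wedge (ω₂.at_ p)).norm ≤
      productConst n Θ₀ C Λ * (ω₁.supNorm (K.cell σ) * ω₂.supPartialDeriv x (K.cell σ) +
        ω₂.supNorm (K.cell σ) * ω₁.supPartialDeriv x (K.cell σ)) * K.mesh := by
  have hη := mesh_nonneg (K := K)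
  have hs₁ := ω₁.supNorm_nonneg (K.cell σ)
  have hs₂ := ω₂.supNorm_nonneg (K.cell σ)
  have ht₁ := ω₁.supPartialDeriv_nonneg x (K.cell σ)
  have ht₂ := ω₂.supPartialDeriv_nonneg x (K.cell σ)
  have hd : ∀ v ∈ σ.1, ∀ w ∈ σ.1, ‖K.vertexCoord x v - K.vertexCoord x w‖ ≤ C * K.mesh :=
    fun v hv w hw => h.norm_vertexCoord_sub_le hx hσ hC0 hC hv hw
  have hd0 : 0 ≤ C * K.mesh := mul_nonneg hC0 hη
  obtain ⟨hdet, δ, hδ, hδη, hdμ1⟩ :=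
    h.exists_abs_mfderivWithin_bary_le hx hσ hΘ₀ hK hC0 hΛ1 hd hΛ
  set D := max 1 (C * (n * (√(n.factorial * (Λ ^ 2) ^ n) / Θ₀ *
    (n.factorial * C ^ (n - 1)) * Λ))) with hDdef
  set P := K.vertexCoord x with hP
  set dμ : V → Module.Dual ℝ (TangentSpace (𝓡 n) p) := fun v =>
    (σ.inclDeriv v ∘ₗ coordsOf (σ.edge P)) ∘ₗ (chartDeriv x p).toLinearMap with hdμ
  -- `dμ` are the differentials of the barycentric coordinates. Since `∑ᵥ dμᵥ ⊗ Pᵥ` is the differential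
  -- of the chart, pulling back the constant forms along it gives the forms at `p`.
  have hW : K.whitney (cup (K.deRham ω₁) (K.deRham ω₂)) σ p =
      whitneyForm (K.bary p) dμ (cup (K.deRham ω₁) (K.deRham ω₂)) := by
    rw [whitney, hdμ]
    congr 1
    ext1 v
    exact h.mfderivWithin_bary hx hσ hdet hp v
  have hwedge : (ω₁.at_ p).wedge (ω₂.at_ p) =
      ((ω₁.inChart x (x p)).wedge (ω₂.inChart x (x p))).comp (∑ v, (dμ v).smulRight (P v)) := by
    rw [ω₁.at_eq_inChart_comp hx (hσ hp), ω₂.at_eq_inChart_comp hx (hσ hp), ← Exterior.wedge_comp,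
      hdμ, sum_inclDeriv_coordsOf_smulRight P hdet]
  have hD : C * K.mesh * δ ≤ D := by
    rw [mul_assoc]
    exact (mul_le_mul_of_nonneg_left hδη hC0).trans (le_max_right _ _)
  have hΛ0 : 0 ≤ Λ := by linarith
  have key := abs_whitneyForm_cup_sub_le (K := K.complex) σ (E := TangentSpace (𝓡 n) p)
    (μ := K.bary p) (dμ := dμ) (fun v => bary_of_notMem hp)
    (fun v hv => by rw [hdμ]; simp only [σ.inclDeriv_of_notMem hv, LinearMap.zero_comp])
    (K.bary_mem p).1.2 (abs_bary_le p)
    (by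
      rw [hdμ]
      ext1 w
      have h0 := LinearMap.congr_fun σ.sum_inclDeriv (coordsOf (σ.edge P) (chartDeriv x p w))
      rw [LinearMap.sum_apply] at h0 ⊢
      exact h0)
    P (ω₁.inChart x (x p)) (ω₂.inChart x (x p))
    (a := K.deRham ω₁) (b := K.deRham ω₂)
    (A := (n + 1) ^ n * Λ ^ n * ω₁.supNorm (K.cell σ))
    (B := (n + 1) ^ n * Λ ^ n * ω₂.supNorm (K.cell σ))
    (A' := n * ((n + 1) ^ n * Λ ^ n * ω₁.supPartialDeriv x (K.cell σ)) * (C * K.mesh))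
    (B' := n * ((n + 1) ^ n * Λ ^ n * ω₂.supPartialDeriv x (K.cell σ)) * (C * K.mesh))
    (by positivity) (by positivity) (by positivity) (by positivity) hd0 hδ (le_max_left _ _) hD
    (hdμ1 p hp)
    (fun j τ hτ => h.abs_deRham_le hx hσ hΛ1 hΛ hd0 hd ω₂ hτ)
    (fun j τ hτ => abs_constCochain_le hx hσ hΛ1 hΛ hd ω₁ hp hτ)
    (fun j τ hτ => h.abs_deRham_sub_constCochain_le hx hσ hΛ1 hΛ hd0 hd ω₁ hp hτ)
    (fun j τ hτ => h.abs_deRham_sub_constCochain_le hx hσ hΛ1 hΛ hd0 hd ω₂ hp hτ)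
  rw [hW, hwedge]
  have hwC := whitneyConst_nonneg n
  have hcC := cupConst_nonneg n
  have hD0 : 0 ≤ D := zero_le_one.trans (le_max_left _ _)
  refine (Exterior.norm_le_of_abs_le (E := TangentSpace (𝓡 n) p) (finrank_tangentSpace p) _
    (by positivity) key).trans (le_of_eq ?_)
  rw [productConst]
  ring

end SmoothTriangulation

end Product

end WhitneyProduct

theorem mainTheorem3
    (n : ℕ) (M : Type*) [TopologicalSpace M] [T2Space M] [CompactSpace M]
    [ChartedSpace (EuclideanSpace ℝ (Fin n)) M] [IsManifold (𝓡 n) ∞ M]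
    [Bundle.RiemannianBundle (fun p : M => TangentSpace (𝓡 n) p)]
    [IsContMDiffRiemannianBundle (𝓡 n) ∞ (EuclideanSpace ℝ (Fin n))
      (fun p : M => TangentSpace (𝓡 n) p)]
    -- the lower bound for the fullness of the triangulations
    (Θ₀ : ℝ) (hΘ₀ : 0 < Θ₀)
    -- finitely many coordinate neighbourhoods, and a compact set in each of them
    (ι : Type*) [Finite ι] (x : ι → OpenPartialHomeomorph M (EuclideanSpace ℝ (Fin n)))
    (hx : ∀ a, x a ∈ IsManifold.maximalAtlas (𝓡 n) ∞ M)
    (L : ι → Set M) (hL : ∀ a, IsCompact (L a)) (hLx : ∀ a, L a ⊆ (x a).source) :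
    ∃ C : ℝ, ∀ (V : Type*) [Fintype V] [LinearOrder V]
      (K : WhitneyProduct.SmoothTriangulation n M V), Θ₀ ≤ K.fullness →
      ∀ (σ : WhitneyProduct.Simplex K.complex n) (a : ι), K.cell σ ⊆ L a → K.IsStraight (x a) σ →
      ∀ ω₁ ω₂ : WhitneyProduct.DiffForm n M, ∀ p ∈ K.cell σ,
        (K.whitney (WhitneyProduct.cup (K.deRham ω₁) (K.deRham ω₂)) σ p -
            (ω₁.at_ p).wedge (ω₂.at_ p)).norm ≤
          C * (ω₁.supNorm (K.cell σ) * ω₂.supPartialDeriv (x a) (K.cell σ) +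
            ω₂.supNorm (K.cell σ) * ω₁.supPartialDeriv (x a) (K.cell σ)) * K.mesh := by
  have hΛ : ∀ a, ∃ Λ : ℝ, 1 ≤ Λ ∧ ∀ p ∈ L a, ∀ v : TangentSpace (𝓡 n) p,
      ‖WhitneyProduct.chartDeriv (x a) p v‖ ≤ Λ * ‖v‖ ∧
        ‖v‖ ≤ Λ * ‖WhitneyProduct.chartDeriv (x a) p v‖ := by
    intro a
    have hsub : x a '' L a ⊆ (x a).target := by
      rintro _ ⟨p, hp, rfl⟩
      exact (x a).map_source (hLx a hp)
    obtain ⟨Λ, hΛ1, hΛ⟩ := WhitneyProduct.exists_norm_chartSymmDeriv_le (hx a)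
      ((hL a).image_of_continuousOn ((x a).continuousOn.mono (hLx a))) hsub
    refine ⟨Λ, hΛ1, fun p hp => ?_⟩
    obtain ⟨y, hy, rfl⟩ : ∃ y ∈ x a '' L a, (x a).symm y = p :=
      ⟨x a p, ⟨p, hp, rfl⟩, (x a).left_inv (hLx a hp)⟩
    intro v
    have h1 := hΛ y hy (WhitneyProduct.chartDeriv (x a) _ v)
    rw [WhitneyProduct.chartSymmDeriv_chartDeriv (hx a) (hsub hy)] at h1
    exact h1.symm
  choose Λ hΛ1 hΛ using hΛ
  choose C hC0 hC using fun a => WhitneyProduct.exists_norm_chart_sub_le (hx a) (hL a) (hLx a)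
  obtain ⟨B, hB⟩ := Finite.exists_le fun a => WhitneyProduct.productConst n Θ₀ (C a) (Λ a)
  refine ⟨B, fun V _ _ K hK σ a hσ hst ω₁ ω₂ p hp => ?_⟩
  refine (hst.norm_whitney_cup_sub_le (hx a) (hσ.trans (hLx a)) hΘ₀ hK (hC0 a) (hΛ1 a)
    (fun p hp q hq => hC a p (hσ hp) q (hσ hq)) (fun p hp => hΛ a p (hσ hp)) ω₁ ω₂ hp).trans ?_
  have hη := WhitneyProduct.SmoothTriangulation.mesh_nonneg (K := K)
  have hs₁ := ω₁.supNorm_nonneg (K.cell σ)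
  have hs₂ := ω₂.supNorm_nonneg (K.cell σ)
  have ht₁ := ω₁.supPartialDeriv_nonneg (x a) (K.cell σ)
  have ht₂ := ω₂.supPartialDeriv_nonneg (x a) (K.cell σ)
  gcongr
  exact hB a
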